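/- **Corollary.** The containment and equivalence problems for deterministic weak nested data class memory automata (NDCMA) are decidable. *Definitions.* A *nested data set of level $l\ge 1$* is a set $\mathcal D$ with a partial predecessor map $\mathrm{pred}:\mathcal D\rightharpoonup\mathcal D$ such that $\mathcal D$ is a forest of infinitely many trees (the roots being the elements without predecessor), every node has level at most $l$ (where $d$ has level $i$ if $\mathrm{pred}^{i-1}(d)$ is a root), and every node of level less than $l$ has infinitely many children. For a set $Q$ write $Q_\bot=Q\cup\{\bot\}$. An *NDCMA of level $l$* is a tuple $\langle Q,\Sigma,\delta,q_0,F_L,F_G\rangle$ with finite sets $Q$ (states) and $\Sigma$ (alphabet), $q_0\in Q$, $F_G\subseteq F_L\subseteq Q$, and $\delta=\bigcup_{1\le i\le l}\delta_i$ with $\delta_i:Q\times\Sigma\times(\{i\}\times(Q_\bot)^i)\to\mathcal P(Q)$. It is *deterministic* if every set in the image of $\delta$ is a singleton, and *weak* if $F_L=Q$. A configuration is a pair $(q,f)$ with $q\in Q$ and $f:\mathcal D\to Q_\bot$ such that $f(d)\ne\bot$ for only finitely many $d$; the initial one is $(q_0,f_0)$ with $f_0\equiv\bot$. On reading $(a,d)\in\Sigma\times\mathcal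 D$ with $d$ of level $i$, the automaton can move from $(q,f)$ to $(q',f')$ if and only if $q'\in\delta(q,a,(i,f(\mathrm{pred}^{i-1}(d)),\dots,f(\mathrm{pred}(d)),f(d)))$ and $f'$ is obtained from $f$ by giving $d$ and all its ancestors $\mathrm{pred}(d),\dots,\mathrm{pred}^{i-1}(d)$ the value $q'$. A configuration $(q,f)$ is final if $q\in F_G$ and $f(d)\in F_L\cup\{\bot\}$ for all $d$. The language $L(\mathcal A)\subseteq(\Sigma\times\mathcal D)^*$ is the set of finite data words on which $\mathcal A$ has a run from the initial configuration to a final one. *Statement.* There are algorithms which, given a level $l$ and two finite inputs, decide whether these inputs describe deterministic weak NDCMA $\mathcal A$ and $\mathcal B$ of level $l$ over a common alphabet such that, respectively, $L(\mathcal A)\subseteq L(\mathcal B)$ (containment) or $L(\mathcal A)=L(\mathcal B)$ (equivalence). The languages are taken over a nested data set of level $l$, and the same algorithms are correct for every such data set. -/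

import Mathlib

universe u

/-- `x 0, …, x i` is the path from a root down to `x i` in the forest with predecessor map `pred`
(`pred d = none` means that `d` is a root). So `x i` has level `i + 1`, and `x j` is
`pred^(i-j) (x i)`. -/
def IsBranch {D : Type u} (pred : D → Option D) {i : ℕ} (x : Fin (i + 1) → D) : Prop :=
  pred (x 0) = none ∧ ∀ j : Fin i, pred (x j.succ) = some (x j.castSucc)

/-- `HasLevel pred d i`: the node `d` is joined to a root by a path with `i` nodes
(roots have level 1). -/
def HasLevel {D : Type u} (pred : D → Option D) (d : D) (i : ℕ) : Prop :=
  ∃ (j : ℕ) (x : Fin (j + 1) → D), i = j + 1 ∧ IsBranch pred x ∧ x (Fin.last j) = d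

/-- A nested data set of level `l`: a forest of infinitely many trees of level `l`, full in the
sense that each node of level less than `l` has infinitely many children. -/
structure NestedDataset (D : Type u) (l : ℕ) where
  pred : D → Option D
  bounded : ∀ d, ∃ i, HasLevel pred d i ∧ i ≤ l
  infinite_roots : {d | pred d = none}.Infinite
  full : ∀ d i, HasLevel pred d i → i < l → {e | pred e = some d}.Infinite

/-- Nested data class memory automata of level `l`, with state set `Q` and input alphabet `S`.
The transition function `δ i` is the one for data values of level `i + 1`; its last argument is
the tuple of the remembered states of the ancestors of the data value that is read, from the root
down to this data value itself (`none` is `⊥`). -/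
structure NDCMA (Q S : Type) [Finite Q] [Finite S] (l : ℕ) where
  init : Q
  δ : (i : Fin l) → Q → S → (Fin (i + 1) → Option Q) → Set Q
  FL : Set Q
  FG : Set Q
  FG_subset_FL : FG ⊆ FL

/-- Configurations: a state and a class memory function. -/
structure NDCMAConfig (Q : Type) (D : Type u) where
  state : Q
  mem : D → Option Q
  finite_mem : {d | mem d ≠ none}.Finite

namespace NDCMA

variable {Q S : Type} [Finite Q] [Finite S] {l : ℕ} {D : Type u}

def Deterministic (A : NDCMA Q S l) : Prop :=
  ∀ (i : Fin l) (q : Q) (a : S) (m : Fin (i + 1) → Option Q), ∃ q', A.δ i q a m = {q'}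

def Weak (A : NDCMA Q S l) : Prop :=
  A.FL = Set.univ

def initConfig (A : NDCMA Q S l) (D : Type u) : NDCMAConfig Q D where
  state := A.init
  mem := fun _ => none
  finite_mem := by simp

def IsFinal (A : NDCMA Q S l) (c : NDCMAConfig Q D) : Prop :=
  c.state ∈ A.FG ∧ ∀ d q, c.mem d = some q → q ∈ A.FL

/-- The transition relation on reading `p = (a, d)`. The new state is stored for `d` and for all
its ancestors; all other data values keep their memory. -/
def Step (A : NDCMA Q S l) (N : NestedDataset D l) (c : NDCMAConfig Q D) (p : S × D)
    (c' : NDCMAConfig Q D) : Prop :=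
  ∃ (i : Fin l) (x : Fin (i + 1) → D), IsBranch N.pred x ∧ x (Fin.last i) = p.2 ∧
    c'.state ∈ A.δ i c.state p.1 (fun j => c.mem (x j)) ∧
    (∀ j, c'.mem (x j) = some c'.state) ∧
    ∀ e, (∀ j, x j ≠ e) → c'.mem e = c.mem e

inductive Run (A : NDCMA Q S l) (N : NestedDataset D l) :
    NDCMAConfig Q D → List (S × D) → NDCMAConfig Q D → Prop
  | nil (c : NDCMAConfig Q D) : Run A N c [] c
  | cons {c c' c'' : NDCMAConfig Q D} {p : S × D} {w : List (S × D)} :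
      Step A N c p c' → Run A N c' w c'' → Run A N c (p :: w) c''

/-- The language of data words over `S × D` that the automaton accepts. -/
def language (A : NDCMA Q S l) (N : NestedDataset D l) : Set (List (S × D)) :=
  {w | ∃ c, A.Run N (A.initConfig D) w c ∧ A.IsFinal c}

end NDCMA

/-- Finite descriptions of automata whose letters and states are numbered:
(number of letters, number of states, initial state, list of transitions, list of locally
accepting states, list of globally accepting states). A transition is listed as
(state, letter, remembered states, new state); the level of the data value that is read is the
length of the list of remembered states. -/
abbrev NDCMACode : Type :=
  ℕ × ℕ × ℕ × List (ℕ × ℕ × List (Option ℕ) × ℕ) × List ℕ × List ℕ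

/-- `c` is a description of the automaton `A`; the lists may be in any order. -/
def NDCMACode.Describes {n k l : ℕ} (c : NDCMACode) (A : NDCMA (Fin n) (Fin k) l) : Prop :=
  match c with
  | (letters, states, q₀, table, locals, globals) =>
    letters = k ∧ states = n ∧ q₀ = A.init.val ∧
    (∀ t, t ∈ table ↔ ∃ (i : Fin l) (q : Fin n) (a : Fin k) (m : Fin (i + 1) → Option (Fin n))
      (q' : Fin n), q' ∈ A.δ i q a m ∧
        t = (q.val, a.val, List.ofFn (fun j => (m j).map Fin.val), q'.val)) ∧
    (∀ s, s ∈ locals ↔ ∃ q ∈ A.FL, s = q.val) ∧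
    (∀ s, s ∈ globals ↔ ∃ q ∈ A.FG, s = q.val)

/-- The pair `(c₁, c₂)` describes deterministic weak NDCMA `A` and `B` of level `l` over a common
alphabet that satisfy `L(A) ⊆ L(B)`. -/
def ContainmentInstance {l : ℕ} {D : Type u} (N : NestedDataset D l) (c₁ c₂ : NDCMACode) : Prop :=
  ∃ (k n₁ n₂ : ℕ) (A : NDCMA (Fin n₁) (Fin k) l) (B : NDCMA (Fin n₂) (Fin k) l),
    c₁.Describes A ∧ c₂.Describes B ∧ A.Deterministic ∧ A.Weak ∧ B.Deterministic ∧ B.Weak ∧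
    A.language N ⊆ B.language N

/-- The pair `(c₁, c₂)` describes deterministic weak NDCMA `A` and `B` of level `l` over a common
alphabet that satisfy `L(A) = L(B)`. -/
def EquivalenceInstance {l : ℕ} {D : Type u} (N : NestedDataset D l) (c₁ c₂ : NDCMACode) : Prop :=
  ∃ (k n₁ n₂ : ℕ) (A : NDCMA (Fin n₁) (Fin k) l) (B : NDCMA (Fin n₂) (Fin k) l),
    c₁.Describes A ∧ c₂.Describes B ∧ A.Deterministic ∧ A.Weak ∧ B.Deterministic ∧ B.Weak ∧
    A.language N = B.language N

-- A weak automaton accepts according to its control state alone, and a deterministic one has a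
-- single run on each word. Hence containment of `A` in `B` fails exactly when the synchronous
-- product of the two automata reaches a configuration whose state pair is accepting on the left and
-- not on the right (`language_subset_iff`). Such a bad configuration puts no condition on the
-- memory, so this is a coverability question.
--
-- The memory of the product is a finite labelled forest of depth at most `l`, with a finite supply
-- of labels. Order such forests by embeddings that keep depth, labels and the ancestor relation in
-- both directions. Steps are monotone: additional remembered nodes never block a step, since
-- reading `⊥` can use a fresh child, and every node above the bottom level has infinitely many
-- children. So the configurations from which a bad one is reachable form an upward closed set, and
-- finite symbolic forests can serve as its generators. The predecessors of the upward closure of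
-- one generator are again given by finitely many generators, computed with `unwrite`:
-- `exists_realizes_unwrite` shows that none is missed, and `exists_writePath_realizes` that each of
-- them really admits a step.
--
-- The order is a well-quasi-order (`partiallyWellOrderedOn_isForest`), by induction on the depth
-- with Higman's lemma. If the backward search meets the initial configuration, there is a bad run
-- (`badRun_of_refuted`). If it never does, then everything it finds has a finite basis, and this
-- basis together with the embeddings that witness its closure under predecessors is a finite
-- certificate (`exists_certificate`) that excludes bad runs (`not_badRun_of_certificate`).
--
-- Thus containment and its negation are both existential statements over primitive recursive
-- relations, and Post's theorem makes containment decidable. Neither the search nor the certificate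
-- mentions the data set, which gives one algorithm for all of them. Equivalence is containment in
-- both directions.

universe v

/-! ### Symbolic memories and their predecessors under a step. -/

section Symbolic

variable {α : Type} {X : Type v}

/-- A symbolic memory `L` lists labelled paths in the forest `List ℕ`. It is realized by a memory
`f` on the forest `List X` if it can be mapped there, respecting lengths, prefixes and labels. -/
def Realizes (f : List X → Option α) (L : List (List ℕ × α)) : Prop :=
  ∃ φ : List ℕ → List X,
    (∀ e ∈ L, (φ e.1).length = e.1.length ∧ f (φ e.1) = some e.2) ∧
    ∀ e ∈ L, ∀ e' ∈ L, (e.1 <+: e'.1 ↔ φ e.1 <+: φ e'.1)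

/-- The order on symbolic memories. -/
def Embeds (L M : List (List ℕ × α)) : Prop :=
  ∃ ψ : List ℕ → List ℕ,
    (∀ e ∈ L, (ψ e.1).length = e.1.length ∧ (ψ e.1, e.2) ∈ M) ∧
    ∀ e ∈ L, ∀ e' ∈ L, (e.1 <+: e'.1 ↔ ψ e.1 <+: ψ e'.1)

/-- The two maps compose. This is what lets a smaller symbolic memory stand in for a larger one
during the backward search. -/
theorem Realizes.of_embeds {f : List X → Option α} {L M : List (List ℕ × α)}
    (h : Realizes f M) (hLM : Embeds L M) : Realizes f L := by
  obtain ⟨φ, h1, h2⟩ := h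
  obtain ⟨ψ, h3, h4⟩ := hLM
  refine ⟨fun p => φ (ψ p), fun e he => ?_, fun e he e' he' => ?_⟩
  · obtain ⟨ha, hb⟩ := h3 e he
    exact ⟨(h1 _ hb).1.trans ha, (h1 _ hb).2⟩
  · exact (h4 e he e' he').trans (h2 _ (h3 e he).2 _ (h3 e' he').2)

/-- Both labels are the value of `f` at the same image node. -/
theorem Realizes.functional {f : List X → Option α} {L : List (List ℕ × α)} (h : Realizes f L) :
    ∀ e ∈ L, ∀ e' ∈ L, e.1 = e'.1 → e.2 = e'.2 := by
  obtain ⟨φ, h1, -⟩ := h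
  intro e he e' he' hee
  have h2 := (h1 e he).2
  rw [hee, (h1 e' he').2] at h2
  exact (Option.some.inj h2).symm

/-- Symbolic memories of depth at most `l` with labels in `Λ` that describe a finite forest. -/
structure IsForest (l : ℕ) (Λ : α → Prop) (L : List (List ℕ × α)) : Prop where
  ne : ∀ e ∈ L, e.1 ≠ []
  len : ∀ e ∈ L, e.1.length ≤ l
  lab : ∀ e ∈ L, Λ e.2
  closed : ∀ e ∈ L, ∀ j < e.1.length, j ≠ 0 → ∃ e' ∈ L, e'.1 = e.1.take j
  functional : ∀ e ∈ L, ∀ e' ∈ L, e.1 = e'.1 → e.2 = e'.2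

theorem IsForest.nil (l : ℕ) (Λ : α → Prop) : IsForest l Λ [] := by
  constructor <;> simp

theorem IsForest.closed_prefix {l : ℕ} {Λ : α → Prop} {L : List (List ℕ × α)}
    (h : IsForest l Λ L) {e : List ℕ × α} (he : e ∈ L) {p : List ℕ} (hp : p ≠ [])
    (hpe : p <+: e.1) : ∃ e' ∈ L, e'.1 = p := by
  rcases hpe.length_le.lt_or_eq with hlt | heq
  · obtain ⟨e', h1, h2⟩ := h.closed e he p.length hlt (by simpa using hp)
    exact ⟨e', h1, h2.trans (List.prefix_iff_eq_take.1 hpe).symm⟩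
  · exact ⟨e, he, (hpe.eq_of_length heq).symm⟩

/-- A set of branches of length at most `l` that is closed under prefixes, with infinitely many
one-step extensions of each branch of length less than `l`. -/
structure IsFullTree (l : ℕ) (V : Set (List X)) : Prop where
  nil_mem : [] ∈ V
  len : ∀ x ∈ V, x.length ≤ l
  closed : ∀ x ∈ V, ∀ p, p <+: x → p ∈ V
  full : ∀ x ∈ V, x.length < l → {d | x ++ [d] ∈ V}.Infinite

/-- The memories that occur in runs. -/
structure IsMemory (V : Set (List X)) (Λ : α → Prop) (f : List X → Option α) : Prop where
  mem : ∀ x, f x ≠ none → x ∈ V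
  nil : f [] = none
  closed : ∀ x, f x ≠ none → ∀ p, p <+: x → p ≠ [] → f p ≠ none
  finite : {x | f x ≠ none}.Finite
  lab : ∀ x a, f x = some a → Λ a

open Classical in
/-- Store the state `q` along the branch `x`. -/
noncomputable def writePath (f : List X → Option α) (q : α) (x : List X) : List X → Option α :=
  fun p => if p ≠ [] ∧ p <+: x then some q else f p

/-- The remembered states along the branch `x`, from the root down. -/
def trace (f : List X → Option α) (x : List X) : List (Option α) :=
  (List.range x.length).map fun k => f (x.take (k + 1))

theorem trace_length (f : List X → Option α) (x : List X) : (trace f x).length = x.length := by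
  simp [trace]

theorem trace_getElem?_eq (f : List X → Option α) (x : List X) (k : ℕ) (a : α) :
    (trace f x)[k]? = some (some a) ↔ k < x.length ∧ f (x.take (k + 1)) = some a := by
  simp [trace, Option.map_eq_some_iff, List.getElem?_eq_some_iff]

theorem IsMemory.empty (V : Set (List X)) (Λ : α → Prop) :
    IsMemory V Λ (fun _ => (none : Option α)) := by
  constructor <;> simp

theorem IsMemory.writePath {l : ℕ} {V : Set (List X)} {Λ : α → Prop} {f : List X → Option α}
    (hf : IsMemory V Λ f) (hV : IsFullTree l V) {x : List X} (hx : x ∈ V) {q : α} (hq : Λ q) :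
    IsMemory V Λ (writePath f q x) where
  mem p hp := by
    by_cases h : p ≠ [] ∧ p <+: x
    · exact hV.closed x hx p h.2
    · exact hf.mem p (by simpa [_root_.writePath, h] using hp)
  nil := by simp [_root_.writePath, hf.nil]
  closed p hp r hr hr0 := by
    by_cases h : r <+: x
    · simp [_root_.writePath, h, hr0]
    · have h1 : ¬ p <+: x := fun h2 => h (hr.trans h2)
      simp only [_root_.writePath, h1, h, and_false, if_false] at hp ⊢
      exact hf.closed p hp r hr hr0
  finite := by
    refine (hf.finite.union (List.finite_toSet x.inits)).subset ?_
    intro p hp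
    by_cases h : p ≠ [] ∧ p <+: x
    · exact Or.inr (by simpa using h.2)
    · exact Or.inl (by simpa [_root_.writePath, h] using hp)
  lab p a hp := by
    by_cases h : p ≠ [] ∧ p <+: x
    · rw [_root_.writePath, if_pos h, Option.some.injEq] at hp
      exact hp ▸ hq
    · exact hf.lab p a (by simpa [_root_.writePath, h] using hp)

/-- The entries that the remembered states `m` prescribe along the path `y`. -/
def marks (m : List (Option α)) (y : List ℕ) : List (List ℕ × α) :=
  (List.range m.length).filterMap fun k => (m[k]?.join).map fun a => (y.take (k + 1), a)

theorem mem_marks {m : List (Option α)} {y : List ℕ} {e : List ℕ × α} :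
    e ∈ marks m y ↔ ∃ k, m[k]? = some (some e.2) ∧ e.1 = y.take (k + 1) := by
  simp only [marks, List.mem_filterMap, List.mem_range, Option.map_eq_some_iff,
    Option.join_eq_some_iff]
  constructor
  · rintro ⟨k, -, a, h, rfl⟩
    exact ⟨k, h, rfl⟩
  · rintro ⟨k, h, h'⟩
    exact ⟨k, (List.getElem?_eq_some_iff.1 h).1, e.2, h, by rw [← h']⟩

/-- The weakest symbolic memory before a step that reads the remembered states `m` along the
path `y` and leads to the symbolic memory `L`. -/
def unwrite (m : List (Option α)) (y : List ℕ) (L : List (List ℕ × α)) : List (List ℕ × α) :=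
  (L.filter fun e => ¬ e.1 <+: y) ++ marks m y

theorem mem_unwrite {m : List (Option α)} {y : List ℕ} {L : List (List ℕ × α)}
    {e : List ℕ × α} : e ∈ unwrite m y L ↔
      (e ∈ L ∧ ¬ e.1 <+: y) ∨ ∃ k, m[k]? = some (some e.2) ∧ e.1 = y.take (k + 1) := by
  simp [unwrite, mem_marks]

/-- Prolong or cut the path `v` to length `i`. -/
def extendPath (v : List ℕ) (i c : ℕ) : List ℕ :=
  (List.range i).map fun k => v.getD k c

theorem extendPath_length (v : List ℕ) (i c : ℕ) : (extendPath v i c).length = i := by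
  simp [extendPath]

theorem prefix_extendPath {v : List ℕ} {i : ℕ} (c : ℕ) (h : v.length ≤ i) :
    v <+: extendPath v i c := by
  rw [List.prefix_iff_getElem?]
  intro k hk
  have : k < i := by omega
  simp [extendPath, List.getElem?_range this, List.getD, hk]

/-- A path that avoids `c` cannot reach into the padding. -/
theorem prefix_of_prefix_extendPath {p v : List ℕ} {i c : ℕ} (h : p <+: extendPath v i c)
    (hc : c ∉ p) : p <+: v := by
  rw [List.prefix_iff_getElem?] at h ⊢
  intro k hk
  have h1 := h k hk
  have hki : k < i := by
    have := (List.getElem?_eq_some_iff.1 h1).1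
    simpa [extendPath] using this
  simp only [extendPath, List.getElem?_map, List.getElem?_range hki, Option.map_some,
    Option.some.injEq] at h1
  rcases hv : v[k]? with _ | a
  · simp only [List.getD, hv, Option.getD_none] at h1
    exact absurd (h1 ▸ List.getElem_mem hk) hc
  · simp only [List.getD, hv, Option.getD_some] at h1
    rw [h1]

/-- A number that occurs in no path of `L`. -/
def freshIndex (L : List (List ℕ × α)) : ℕ :=
  (L.flatMap Prod.fst).sum + 1

theorem freshIndex_notMem {L : List (List ℕ × α)} {e : List ℕ × α} (he : e ∈ L) :
    freshIndex L ∉ e.1 := by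
  intro h
  have : freshIndex L ≤ (L.flatMap Prod.fst).sum :=
    List.single_le_sum (by simp) _ (List.mem_flatMap.2 ⟨e, he, h⟩)
  simp [freshIndex] at this

/-- Among the prefixes of one fixed path the prefix order is just comparison of lengths, so it
carries over to any other path of the same length. -/
theorem prefix_take_iff {β γ : Type*} {p p' y : List β} {x : List γ} (hxy : x.length = y.length)
    (hp : p <+: y) (hp' : p' <+: y) :
    p <+: p' ↔ x.take p.length <+: x.take p'.length := by
  have h1 := hp.length_le
  have h2 := hp'.length_le
  constructor
  · intro h
    exact List.take_prefix_take_left h.length_le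
  · intro h
    refine List.prefix_of_prefix_length_le hp hp' ?_
    have := h.length_le
    simp at this
    omega

open Classical in
/-- Every step that leads to a memory realizing `L` starts in a memory realizing one of finitely
many symbolic predecessors of `L`. -/
theorem exists_realizes_unwrite {l : ℕ} {V : Set (List X)} {Λ : α → Prop}
    {f : List X → Option α} {L : List (List ℕ × α)} (hV : IsFullTree l V) (hf : IsMemory V Λ f)
    (hL : IsForest l Λ L) {x : List X} (hx : x ∈ V) {q : α}
    (h : Realizes (writePath f q x) L) :
    ∃ v, (v = [] ∨ ∃ e ∈ L, v = e.1) ∧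
      (∀ e ∈ L, e.1 <+: extendPath v x.length (freshIndex L) → e.2 = q) ∧
      IsForest l Λ (unwrite (trace f x) (extendPath v x.length (freshIndex L)) L) ∧
      Realizes f (unwrite (trace f x) (extendPath v x.length (freshIndex L)) L) := by
  obtain ⟨φ, h1, h2⟩ := h
  have hφne : ∀ e ∈ L, φ e.1 ≠ [] := fun e he h0 => by
    have := (h1 e he).1
    rw [h0] at this
    exact hL.ne e he (List.length_eq_zero_iff.1 this.symm)
  -- the longest path of `L` that is mapped to a prefix of `x`
  obtain ⟨v, hv, hvx, hvmax⟩ : ∃ v, (v = [] ∨ ∃ e ∈ L, v = e.1) ∧ v.length ≤ x.length ∧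
      ∀ e ∈ L, (e.1 <+: v ↔ φ e.1 <+: x) := by
    by_cases hex : ∃ e ∈ L, φ e.1 <+: x
    · obtain ⟨e, he, hmax⟩ := ((L.filter fun e => φ e.1 <+: x).toFinset).exists_max_image
        (fun e => e.1.length) (by
          obtain ⟨e, he, hex⟩ := hex
          exact ⟨e, by simp [he, hex]⟩)
      simp only [List.mem_toFinset, List.mem_filter, decide_eq_true_eq] at he hmax
      refine ⟨e.1, Or.inr ⟨e, he.1, rfl⟩, ?_, fun e' he' => ?_⟩
      · rw [← (h1 e he.1).1]
        exact he.2.length_le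
      · rw [h2 e' he' e he.1]
        refine ⟨fun h => h.trans he.2, fun h => List.prefix_of_prefix_length_le h he.2 ?_⟩
        rw [(h1 e he.1).1, (h1 e' he').1]
        exact hmax e' ⟨he', h⟩
    · push Not at hex
      refine ⟨[], Or.inl rfl, by simp, fun e he => ?_⟩
      simp [hL.ne e he, hex e he]
  refine ⟨v, hv, ?_⟩
  -- The path `y` is the symbolic copy of `x`: the part `v` is already named by `L`, and the fresh
  -- padding names the nodes of `x` below it, which no entry of `L` is mapped to.
  set y := extendPath v x.length (freshIndex L) with hy
  have hylen : y.length = x.length := extendPath_length _ _ _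
  have hpre : ∀ e ∈ L, (e.1 <+: y ↔ φ e.1 <+: x) := fun e he => by
    rw [← hvmax e he]
    exact ⟨fun h => prefix_of_prefix_extendPath h (freshIndex_notMem he),
      fun h => h.trans (prefix_extendPath _ hvx)⟩
  have htake : ∀ e ∈ L, e.1 <+: y → φ e.1 = x.take e.1.length := fun e he h => by
    have := List.prefix_iff_eq_take.1 ((hpre e he).1 h)
    rwa [(h1 e he).1] at this
  have hkept : ∀ e ∈ L, ¬ e.1 <+: y → f (φ e.1) = some e.2 := fun e he h => by
    have h3 := (h1 e he).2
    rw [hpre e he] at h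
    simpa [writePath, h] using h3
  -- The old map is kept off `y`, while `y` itself is laid along `x`; the two agree on the entries
  -- of `L` by `htake`.
  let φ' : List ℕ → List X := fun p => if p <+: y then x.take p.length else φ p
  have hnew : ∀ k a, (trace f x)[k]? = some (some a) →
      k < x.length ∧ f (x.take (k + 1)) = some a := fun k a h => (trace_getElem?_eq f x k a).1 h
  have htl : ∀ k, k < x.length → (y.take (k + 1)).length = k + 1 := fun k hk => by
    simp [hylen]; omega
  have hreal : Realizes f (unwrite (trace f x) y L) := by
    refine ⟨φ', fun e he => ?_, fun e he e' he' => ?_⟩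
    · rcases mem_unwrite.1 he with ⟨he, hey⟩ | ⟨k, hk, hek⟩
      · simp only [φ', hey, if_false]
        exact ⟨(h1 e he).1, hkept e he hey⟩
      · have hey : e.1 <+: y := hek ▸ List.take_prefix _ _
        obtain ⟨hk1, hk2⟩ := hnew k _ hk
        have hl : e.1.length = k + 1 := hek ▸ htl k hk1
        simp only [φ', hey, if_true]
        rw [hl]
        exact ⟨by simp; omega, hk2⟩
    · by_cases hey : e.1 <+: y <;> by_cases hey' : e'.1 <+: y
      · simp only [φ', hey, hey', if_true]
        exact prefix_take_iff hylen.symm hey hey'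
      · simp only [φ', hey, hey', if_true, if_false]
        have he'L : e' ∈ L := by
          rcases mem_unwrite.1 he' with h | ⟨k, hk, hek⟩
          · exact h.1
          · exact absurd (hek ▸ List.take_prefix _ _) hey'
        have hene : e.1 ≠ [] := by
          rcases mem_unwrite.1 he with h | ⟨k, hk, hek⟩
          · exact hL.ne e h.1
          · intro h0
            have := htl k (hnew k _ hk).1
            rw [← hek, h0] at this
            simp at this
        constructor
        · intro h
          obtain ⟨r, hr, hre⟩ := hL.closed_prefix he'L hene h
          rw [← hre, ← htake r hr (hre ▸ hey), ← h2 r hr e' he'L, hre]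
          exact h
        -- The ancestor of `φ e'.1` at the depth of `e.1` is the image of some path `r` in `L`. It
        -- lies on `x`, so `r` lies on `y` and must coincide with `e.1`.
        · intro h
          have hle : e.1.length ≤ e'.1.length := by
            have := h.length_le
            rw [(h1 e' he'L).1, List.length_take] at this
            have := hey.length_le
            omega
          have htne : e'.1.take e.1.length ≠ [] := by
            intro h0
            have := congrArg List.length h0
            simp at this
            rcases this with h | h
            · exact hene h
            · exact hL.ne e' he'L h
          obtain ⟨r, hr, hre⟩ := hL.closed_prefix he'L htne (List.take_prefix _ _)
          have hrl : r.1.length = e.1.length := by rw [hre]; simp [hle]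
          have h3 : φ r.1 <+: φ e'.1 := by
            rw [← h2 r hr e' he'L, hre]; exact List.take_prefix _ _
          have h4 : φ r.1 = x.take e.1.length := by
            refine (List.prefix_of_prefix_length_le h3 h ?_).eq_of_length ?_
            all_goals
              have := hey.length_le
              simp [(h1 r hr).1, hrl]; omega
          have h5 : r.1 <+: y := (hpre r hr).2 (h4 ▸ List.take_prefix _ _)
          have h6 : r.1 = e.1 :=
            (List.prefix_of_prefix_length_le h5 hey hrl.le).eq_of_length hrl
          rw [← h6, hre]
          exact List.take_prefix _ _
      · have heL : e ∈ L := by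
          rcases mem_unwrite.1 he with h | ⟨k, hk, hek⟩
          · exact h.1
          · exact absurd (hek ▸ List.take_prefix _ _) hey
        simp only [φ', hey, hey', if_true, if_false]
        refine ⟨fun h => absurd (h.trans hey') hey, fun h => ?_⟩
        exact absurd ((hpre e heL).2 (h.trans (List.take_prefix _ _))) hey
      · have heL : e ∈ L := by
          rcases mem_unwrite.1 he with h | ⟨k, hk, hek⟩
          · exact h.1
          · exact absurd (hek ▸ List.take_prefix _ _) hey
        have heL' : e' ∈ L := by
          rcases mem_unwrite.1 he' with h | ⟨k, hk, hek⟩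
          · exact h.1
          · exact absurd (hek ▸ List.take_prefix _ _) hey'
        simp only [φ', hey, hey', if_false]
        exact h2 e heL e' heL'
  refine ⟨fun e he hey => ?_, ⟨fun e he => ?_, fun e he => ?_, fun e he => ?_,
    fun e he j hj hj0 => ?_, hreal.functional⟩, hreal⟩
  · have h3 := (h1 e he).2
    rw [writePath, if_pos ⟨hφne e he, (hpre e he).1 hey⟩] at h3
    exact (Option.some.inj h3).symm
  · rcases mem_unwrite.1 he with h | ⟨k, hk, hek⟩
    · exact hL.ne e h.1
    · intro h0
      have := htl k (hnew k _ hk).1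
      rw [← hek, h0] at this
      simp at this
  · rcases mem_unwrite.1 he with h | ⟨k, hk, hek⟩
    · exact hL.len e h.1
    · rw [hek]
      have := hV.len x hx
      simp; omega
  · rcases mem_unwrite.1 he with h | ⟨k, hk, hek⟩
    · exact hL.lab e h.1
    · exact hf.lab _ _ (hnew k _ hk).2
  -- Entries of `L` along `y` have been deleted, so an ancestor of a surviving entry may be missing.
  -- It comes back as a mark, because in `f` every ancestor of a remembered node is remembered.
  · have key : ∀ i, i ≠ 0 → i ≤ x.length → f (x.take i) ≠ none →
        ∃ e' ∈ unwrite (trace f x) y L, e'.1 = y.take i := by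
      intro i hi0 hi hfi
      obtain ⟨a, ha⟩ := Option.ne_none_iff_exists'.1 hfi
      refine ⟨(y.take i, a), mem_unwrite.2 (Or.inr ⟨i - 1, ?_, ?_⟩), rfl⟩
      · rw [trace_getElem?_eq, Nat.sub_add_cancel (by omega)]
        exact ⟨by omega, ha⟩
      · rw [Nat.sub_add_cancel (by omega)]
    rcases mem_unwrite.1 he with ⟨heL, hey⟩ | ⟨k, hk, hek⟩
    · obtain ⟨r, hr, hre⟩ := hL.closed e heL j hj hj0
      by_cases hry : r.1 <+: y
      · have hrl : r.1.length = j := by rw [hre]; simp; omega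
        have hry' : r.1 = y.take j := by
          have := List.prefix_iff_eq_take.1 hry
          rwa [hrl] at this
        have h3 : φ r.1 <+: φ e.1 := by
          rw [← h2 r hr e heL, hre]; exact List.take_prefix _ _
        have h4 : f (φ r.1) ≠ none :=
          hf.closed _ (by rw [hkept e heL hey]; simp) _ h3 (hφne r hr)
        rw [htake r hr hry, hrl] at h4
        rw [← hre, hry']
        refine key j hj0 ?_ h4
        have := hry.length_le
        omega
      · exact ⟨r, mem_unwrite.2 (Or.inl ⟨hr, hry⟩), hre⟩
    · obtain ⟨hk1, hk2⟩ := hnew k _ hk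
      have hl : e.1.length = k + 1 := hek ▸ htl k hk1
      have hej : e.1.take j = y.take j := by
        rw [hek, List.take_take, min_eq_left (by omega)]
      rw [hej]
      refine key j hj0 (by omega) (hf.closed _ (by rw [hk2]; simp) _ ?_ ?_)
      · exact List.take_prefix_take_left (by omega)
      · intro h0
        have := congrArg List.length h0
        rw [List.length_take, List.length_nil] at this
        omega

/-- A branch can be prolonged to any length up to `l` outside a given finite set. -/
theorem IsFullTree.exists_extend {l : ℕ} {V : Set (List X)} (hV : IsFullTree l V)
    {F : Set (List X)} (hF : F.Finite) {x : List X} (hx : x ∈ V) (n : ℕ)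
    (hn : x.length + n ≤ l) :
    ∃ z ∈ V, x <+: z ∧ z.length = x.length + n ∧
      ∀ k, x.length < k → k ≤ z.length → z.take k ∉ F := by
  induction n with
  | zero => exact ⟨x, hx, List.prefix_rfl, rfl, fun k h1 h2 => by omega⟩
  | succ n ih =>
    obtain ⟨z, hz, hxz, hlen, hzF⟩ := ih (by omega)
    have hinj : Function.Injective fun d => z ++ [d] := fun a b h => by simpa using h
    -- Infinitely many children are available and only finitely many of them lie in `F`.
    obtain ⟨d, hd, hdF⟩ := (hV.full z hz (by omega)).exists_notMem_finite
      (hF.preimage hinj.injOn)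
    refine ⟨z ++ [d], hd, hxz.trans (List.prefix_append _ _), by simp [hlen]; omega,
      fun k h1 h2 => ?_⟩
    rcases h2.lt_or_eq with h3 | h3
    · have : k ≤ z.length := by simp at h3; omega
      rw [List.take_append_of_le_length this]
      exact hzF k h1 this
    · rw [h3, List.take_length]
      exact hdF

open Classical in
/-- From every memory realizing a symbolic predecessor of `L` there is a step to a memory
realizing `L`. -/
theorem exists_writePath_realizes {l : ℕ} {V : Set (List X)} {Λ : α → Prop}
    {f : List X → Option α} {L : List (List ℕ × α)} (hV : IsFullTree l V) (hf : IsMemory V Λ f)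
    {m : List (Option α)} {y : List ℕ} {q : α} (hym : y.length = m.length) (hml : m.length ≤ l)
    (hq : ∀ e ∈ L, e.1 <+: y → e.2 = q) (hne : ∀ e ∈ L, e.1 ≠ [])
    (hW : IsForest l Λ (unwrite m y L)) (h : Realizes f (unwrite m y L)) :
    ∃ x ∈ V, trace f x = m ∧ Realizes (writePath f q x) L := by
  obtain ⟨φ, h1, h2⟩ := h
  -- the length of the part of `y` that is remembered
  obtain ⟨s, hsm, hs0, hs⟩ : ∃ s ≤ m.length, (s = 0 ∨ ∃ a, m[s - 1]? = some (some a)) ∧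
      ∀ (k : ℕ) (a : α), m[k]? = some (some a) → k < s := by
    by_cases hex : ∃ (k : ℕ) (a : α), m[k]? = some (some a)
    · have hbd : ∀ (k : ℕ) (a : α), m[k]? = some (some a) → k < m.length :=
        fun k a h => (List.getElem?_eq_some_iff.1 h).1
      let P : ℕ → Prop := fun k => ∃ a, m[k]? = some (some a)
      obtain ⟨k, hk⟩ := hex
      have hkb : k ≤ m.length := (hbd k _ hk.choose_spec).le
      have hP : P (Nat.findGreatest P m.length) := Nat.findGreatest_spec hkb hk
      refine ⟨Nat.findGreatest P m.length + 1, ?_, Or.inr (by simpa using hP), fun j a hj => ?_⟩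
      · obtain ⟨a, ha⟩ := hP
        exact hbd _ a ha
      · exact Nat.lt_succ_of_le (Nat.le_findGreatest (hbd j a hj).le ⟨a, hj⟩)
    · push Not at hex
      exact ⟨0, by simp, Or.inl rfl, fun k a h => absurd h (hex k a)⟩
  have hym' : ∀ k, k ≤ m.length → (y.take k).length = k := fun k hk => by simp; omega
  -- The last non-`⊥` entry of `m` is at index `s - 1`, hence at depth `s`. Closure of the forest
  -- under ancestors then rules out gaps: the first `s` entries of `m` are all different from `⊥`.
  have hWs : ∀ k, k ≠ 0 → k ≤ s → ∃ e ∈ unwrite m y L, e.1 = y.take k := by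
    intro k hk0 hks
    rcases hs0 with rfl | ⟨a, ha⟩
    · omega
    · have hmem : (y.take s, a) ∈ unwrite m y L :=
        mem_unwrite.2 (Or.inr ⟨s - 1, ha, by rw [Nat.sub_add_cancel (by omega)]⟩)
      refine hW.closed_prefix hmem ?_ (List.take_prefix_take_left hks)
      intro h0
      have := hym' k (by omega)
      rw [h0] at this
      simp at this
      omega
  -- entries on the path `y`
  have hon : ∀ e ∈ unwrite m y L, e.1 <+: y →
      e.1 = y.take e.1.length ∧ e.1.length ≠ 0 ∧ m[e.1.length - 1]? = some (some e.2) ∧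
        e.1.length ≤ s := by
    intro e he hey
    rcases mem_unwrite.1 he with h | ⟨k, hk, hek⟩
    · exact absurd hey h.2
    · have hks := hs k _ hk
      have hl : e.1.length = k + 1 := by rw [hek, hym' _ (by omega)]
      rw [hl]
      exact ⟨hek, by omega, by simpa using hk, by omega⟩
  have hoff : ∀ e ∈ unwrite m y L, ¬ e.1 <+: y → e ∈ L := by
    intro e he hey
    rcases mem_unwrite.1 he with h | ⟨k, hk, hek⟩
    · exact h.1
    · exact absurd (hek ▸ List.take_prefix _ _) hey
  -- The branch to be read begins with the image of the remembered part of `y`.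
  obtain ⟨x₀, hx₀, hx₀l, hx₀s⟩ : ∃ x₀ ∈ V, x₀.length = s ∧
      ∀ e ∈ unwrite m y L, (e.1 <+: y ↔ φ e.1 <+: x₀) := by
    by_cases hs1 : s = 0
    · subst hs1
      refine ⟨[], hV.nil_mem, rfl, fun e he => ⟨fun hey => ?_, fun h0 => ?_⟩⟩
      · have := hon e he hey
        omega
      · have := (h1 e he).1
        rw [List.prefix_nil.1 h0] at this
        exact absurd (List.length_eq_zero_iff.1 this.symm) (hW.ne e he)
    · obtain ⟨r, hr, hre⟩ := hWs s hs1 le_rfl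
      refine ⟨φ r.1, hf.mem _ (by rw [(h1 r hr).2]; simp), ?_, fun e he => ?_⟩
      · rw [(h1 r hr).1, hre, hym' s hsm]
      · rw [← h2 e he r hr, hre]
        refine ⟨fun hey => ?_, fun hey => hey.trans (List.take_prefix _ _)⟩
        obtain ⟨h3, -, -, h4⟩ := hon e he hey
        rw [h3]
        exact List.take_prefix_take_left h4
  -- The remaining entries of `m` are `⊥`, so the branch continues through nodes outside the finite
  -- support of `f`.
  obtain ⟨x, hx, hx₀x, hxl, hxF⟩ := hV.exists_extend hf.finite hx₀ (m.length - s) (by omega)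
  replace hxl : x.length = m.length := by omega
  have hfresh : ∀ k, s < k → k ≤ m.length → f (x.take k) = none := fun k hk hk' => by
    have := hxF k (by omega) (by omega)
    simpa using this
  have htk : ∀ k, k ≤ m.length → (x.take k).length = k := fun k hk => by simp; omega
  -- Images under `φ` are remembered nodes, whereas the nodes of `x` below `x₀` are not; so an image
  -- that lies on `x` already lies on `x₀`.
  have hφx : ∀ e ∈ unwrite m y L, (e.1 <+: y ↔ φ e.1 <+: x) := by
    intro e he
    rw [hx₀s e he]
    refine ⟨fun h => h.trans hx₀x, fun h => ?_⟩
    refine List.prefix_of_prefix_length_le h hx₀x ?_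
    by_contra hlt
    have h3 := hfresh (φ e.1).length (by omega) (by rw [← hxl]; exact h.length_le)
    rw [← List.prefix_iff_eq_take.1 h, (h1 e he).2] at h3
    simp at h3
  have hφt : ∀ e ∈ unwrite m y L, e.1 <+: y → φ e.1 = x.take e.1.length := by
    intro e he hey
    have := List.prefix_iff_eq_take.1 ((hφx e he).1 hey)
    rwa [(h1 e he).1] at this
  have htrace : trace f x = m := by
    refine List.ext_getElem? fun k => ?_
    by_cases hk : k < m.length
    · have h3 : (trace f x)[k]? = some (f (x.take (k + 1))) := by
        simp [trace, hxl, List.getElem?_range hk]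
      rw [h3]
      by_cases hks : k < s
      · obtain ⟨e, he, hek⟩ := hWs (k + 1) (by omega) (by omega)
        have hey : e.1 <+: y := hek ▸ List.take_prefix _ _
        have hl : e.1.length = k + 1 := by rw [hek, hym' _ (by omega)]
        obtain ⟨-, -, h4, -⟩ := hon e he hey
        have h5 := (h1 e he).2
        rw [hφt e he hey, hl] at h5
        rw [h5, ← h4, hl]
        simp
      · rw [hfresh (k + 1) (by omega) (by omega), List.getElem?_eq_getElem hk]
        rcases hmk : m[k] with _ | a
        · rfl
        · exact absurd (hs k a (by rw [List.getElem?_eq_getElem hk, hmk])) hks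
    · rw [List.getElem?_eq_none (by rw [trace_length]; omega), List.getElem?_eq_none (by omega)]
  refine ⟨x, hx, htrace, fun p => if p <+: y then x.take p.length else φ p, fun e he => ?_,
    fun e he e' he' => ?_⟩
  · by_cases hey : e.1 <+: y
    · have h3 := hey.length_le
      simp only [hey, if_true]
      have h4 : (x.take e.1.length).length = e.1.length := htk _ (by omega)
      refine ⟨h4, ?_⟩
      have h5 : x.take e.1.length ≠ [] := fun h0 => by
        rw [h0] at h4
        exact hne e he (List.length_eq_zero_iff.1 h4.symm)
      rw [writePath, if_pos ⟨h5, List.take_prefix _ _⟩, hq e he hey]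
    · have heW : e ∈ unwrite m y L := mem_unwrite.2 (Or.inl ⟨he, hey⟩)
      simp only [hey, if_false]
      refine ⟨(h1 e heW).1, ?_⟩
      rw [writePath, if_neg, (h1 e heW).2]
      rw [← hφx e heW]
      exact fun h => hey h.2
  · have hxy : x.length = y.length := by omega
    by_cases hey : e.1 <+: y <;> by_cases hey' : e'.1 <+: y
    · simp only [hey, hey', if_true]
      exact prefix_take_iff hxy hey hey'
    · have heW' : e' ∈ unwrite m y L := mem_unwrite.2 (Or.inl ⟨he', hey'⟩)
      simp only [hey, hey', if_true, if_false]
      have hle := hey.length_le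
      have htl := htk e.1.length (by omega)
      have hpos : e.1.length ≠ 0 := fun h0 => hne e he (List.length_eq_zero_iff.1 h0)
      constructor
      · intro h
        obtain ⟨r, hr, hre⟩ := hW.closed_prefix heW' (hne e he) h
        rw [← hre, ← hφt r hr (hre ▸ hey), ← h2 r hr e' heW', hre]
        exact h
      · intro h
        -- The path `e.1` may have no entry before the step. As an ancestor of a remembered node,
        -- the node at its depth on `x` is remembered, which bounds this depth by `s` and provides
        -- the missing entry `r`.
        have h3 : f (x.take e.1.length) ≠ none := by
          refine hf.closed _ (by rw [(h1 e' heW').2]; simp) _ h fun h0 => ?_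
          rw [h0] at htl
          exact hpos htl.symm
        have h4 : e.1.length ≤ s := by
          by_contra hlt
          exact h3 (hfresh _ (by omega) (by omega))
        obtain ⟨r, hr, hre⟩ := hWs e.1.length hpos h4
        have hre' : r.1 = e.1 := hre.trans (List.prefix_iff_eq_take.1 hey).symm
        rw [← hre', h2 r hr e' heW', hφt r hr (hre' ▸ hey), hre']
        exact h
    · have heW : e ∈ unwrite m y L := mem_unwrite.2 (Or.inl ⟨he, hey⟩)
      simp only [hey, hey', if_true, if_false]
      refine ⟨fun h => absurd (h.trans hey') hey, fun h => ?_⟩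
      exact absurd ((hφx e heW).2 (h.trans (List.take_prefix _ _))) hey
    · simp only [hey, hey', if_false]
      exact h2 e (mem_unwrite.2 (Or.inl ⟨he, hey⟩)) e' (mem_unwrite.2 (Or.inl ⟨he', hey'⟩))

end Symbolic

/-! ### Well-quasi-ordering of labelled forests of bounded depth. -/

section WellQuasiOrder

variable {α : Type}

instance : IsPreorder (List (List ℕ × α)) Embeds where
  refl L := ⟨id, fun e he => ⟨rfl, he⟩, fun _ _ _ _ => Iff.rfl⟩
  trans L M N := by
    rintro ⟨φ, h1, h2⟩ ⟨ψ, h3, h4⟩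
    refine ⟨fun p => ψ (φ p), fun e he => ?_, fun e he e' he' => ?_⟩
    · obtain ⟨ha, hb⟩ := h1 e he
      exact ⟨(h3 _ hb).1.trans ha, (h3 _ hb).2⟩
    · exact (h2 e he e' he').trans (h4 _ (h1 e he).2 _ (h1 e' he').2)

/-- The order on trees with a root index, a root label and the forest below the root; the root
index is ignored. -/
def TreeEmbeds (t t' : ℕ × α × List (List ℕ × α)) : Prop :=
  t.2.1 = t'.2.1 ∧ Embeds t.2.2 t'.2.2

instance : IsPreorder (ℕ × α × List (List ℕ × α)) TreeEmbeds where
  refl t := ⟨rfl, refl_of Embeds t.2.2⟩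
  trans _ _ _ h h' := ⟨h.1.trans h'.1, trans_of Embeds h.2 h'.2⟩

/-- The forest below the root `n` of `L`. -/
def subforest (n : ℕ) (L : List (List ℕ × α)) : List (List ℕ × α) :=
  L.filterMap fun e =>
    if e.1.head? = some n ∧ e.1.tail ≠ [] then some (e.1.tail, e.2) else none

theorem mem_subforest {n : ℕ} {L : List (List ℕ × α)} {e : List ℕ × α} :
    e ∈ subforest n L ↔ e.1 ≠ [] ∧ (n :: e.1, e.2) ∈ L := by
  simp only [subforest, List.mem_filterMap, Option.ite_none_right_eq_some, Option.some.injEq]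
  constructor
  · rintro ⟨⟨p, a⟩, h, ⟨h1, h2⟩, rfl⟩
    cases p with
    | nil => simp at h1
    | cons k p =>
      simp only [List.head?_cons, Option.some.injEq] at h1
      subst h1
      exact ⟨h2, h⟩
  · rintro ⟨h1, h2⟩
    exact ⟨_, h2, ⟨rfl, h1⟩, rfl⟩

theorem IsForest.subforest {l : ℕ} {Λ : α → Prop} {L : List (List ℕ × α)}
    (h : IsForest (l + 1) Λ L) (n : ℕ) : IsForest l Λ (subforest n L) where
  ne e he := (mem_subforest.1 he).1
  len e he := by simpa using h.len _ (mem_subforest.1 he).2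
  lab e he := h.lab (n :: e.1, e.2) (mem_subforest.1 he).2
  closed e he j hj hj0 := by
    obtain ⟨e', h1, h2⟩ := h.closed _ (mem_subforest.1 he).2 (j + 1) (by simpa using hj) (by simp)
    refine ⟨(e.1.take j, e'.2), mem_subforest.2 ⟨?_, ?_⟩, rfl⟩
    · intro h0
      have := congrArg List.length h0
      rw [List.length_take, List.length_nil] at this
      omega
    · rw [List.take_succ_cons] at h2
      rw [← h2]
      exact h1
  functional e he e' he' hee := h.functional (n :: e.1, e.2) (mem_subforest.1 he).2
    (n :: e'.1, e'.2) (mem_subforest.1 he').2 (by simp [hee])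

/-- Cuts a forest into its trees, so that Higman's lemma for lists applies. Repeated entries are
removed by `dedup`, and since labels are functional a root index determines its tree. -/
theorem IsForest.exists_trees {l : ℕ} {Λ : α → Prop} {L : List (List ℕ × α)}
    (h : IsForest l Λ L) : ∃ T : List (ℕ × α × List (List ℕ × α)), (T.map Prod.fst).Nodup ∧
      ∀ t, t ∈ T ↔ ([t.1], t.2.1) ∈ L ∧ t.2.2 = _root_.subforest t.1 L := by
  classical
  let T := (L.filterMap fun e => if e.1.length = 1 then
    some (e.1.headI, e.2, _root_.subforest e.1.headI L) else none).dedup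
  have hmem : ∀ t, t ∈ T ↔ ([t.1], t.2.1) ∈ L ∧ t.2.2 = _root_.subforest t.1 L := by
    rintro ⟨n, a, M⟩
    simp only [T, List.mem_dedup, List.mem_filterMap, Option.ite_none_right_eq_some,
      Option.some.injEq, Prod.mk.injEq]
    constructor
    · rintro ⟨⟨p, b⟩, h1, h2, h3, rfl, rfl⟩
      obtain ⟨k, rfl⟩ := List.length_eq_one_iff.1 h2
      simp only [List.headI_cons] at h3
      subst h3
      exact ⟨h1, rfl⟩
    · rintro ⟨h1, rfl⟩
      exact ⟨_, h1, rfl, rfl, rfl, rfl⟩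
  refine ⟨T, List.Nodup.map_on ?_ (List.nodup_dedup _), hmem⟩
  rintro ⟨n, a, M⟩ ht ⟨n', a', M'⟩ ht' hnn
  obtain ⟨h1, h2⟩ := (hmem _).1 ht
  obtain ⟨h3, h4⟩ := (hmem _).1 ht'
  dsimp only at hnn h1 h2 h3 h4
  subst hnn
  have := h.functional _ h1 _ h3 rfl
  simp_all

/-- A sublist matching sends different positions to different positions. As the indices in each list
are distinct, it can be read as an injection between root indices. -/
theorem List.SublistForall₂.exists_injection {β : Type*} {r : ℕ × β → ℕ × β → Prop}
    {T T' : List (ℕ × β)} (h : List.SublistForall₂ r T T') (hT : (T.map Prod.fst).Nodup)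
    (hT' : (T'.map Prod.fst).Nodup) :
    ∃ g : ℕ → ℕ, (∀ t ∈ T, ∃ t' ∈ T', t'.1 = g t.1 ∧ r t t') ∧
      ∀ t ∈ T, ∀ s ∈ T, g t.1 = g s.1 → t.1 = s.1 := by
  induction h with
  | nil => exact ⟨id, by simp, by simp⟩
  | @cons a b l₁ l₂ hab _ ih =>
    rw [List.map_cons, List.nodup_cons] at hT hT'
    obtain ⟨g, h1, h2⟩ := ih hT.2 hT'.2
    have hne : ∀ t ∈ l₁, t.1 ≠ a.1 := fun t ht h =>
      hT.1 (h ▸ List.mem_map_of_mem ht)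
    have hne' : ∀ t ∈ l₁, g t.1 ≠ b.1 := fun t ht h => by
      obtain ⟨t', ht', h3, -⟩ := h1 t ht
      exact hT'.1 (h ▸ h3 ▸ List.mem_map_of_mem ht')
    refine ⟨Function.update g a.1 b.1, ?_, ?_⟩
    · intro t ht
      rcases List.mem_cons.1 ht with rfl | ht
      · exact ⟨b, by simp, by simp, hab⟩
      · obtain ⟨t', ht', h3, h4⟩ := h1 t ht
        exact ⟨t', List.mem_cons_of_mem _ ht', by simp [hne t ht, h3], h4⟩
    · intro t ht s hs hts
      rcases List.mem_cons.1 ht with h3 | ht <;> rcases List.mem_cons.1 hs with h4 | hs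
      · rw [h3, h4]
      · rw [h3, Function.update_self, Function.update_of_ne (hne s hs)] at hts
        exact absurd hts.symm (hne' s hs)
      · rw [h4, Function.update_self, Function.update_of_ne (hne t ht)] at hts
        exact absurd hts (hne' t ht)
      · rw [Function.update_of_ne (hne s hs), Function.update_of_ne (hne t ht)] at hts
        exact h2 t ht s hs hts
  | @cons_right b l₁ l₂ _ ih =>
    rw [List.map_cons, List.nodup_cons] at hT'
    obtain ⟨g, h1, h2⟩ := ih hT hT'.2
    refine ⟨g, fun t ht => ?_, h2⟩
    obtain ⟨t', ht', h3⟩ := h1 t ht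
    exact ⟨t', List.mem_cons_of_mem _ ht', h3⟩

theorem IsForest.exists_root {l : ℕ} {Λ : α → Prop} {L : List (List ℕ × α)}
    (h : IsForest l Λ L) {n : ℕ} {p : List ℕ} {a : α} (hp : (n :: p, a) ∈ L) :
    ∃ b, ([n], b) ∈ L := by
  obtain ⟨⟨_, b⟩, h1, rfl⟩ := h.closed_prefix hp (p := [n]) (by simp) (by simp)
  exact ⟨b, h1⟩

/-- The embeddings of the matched trees are glued along the injection of their roots. Injectivity
keeps paths with different roots incomparable. -/
theorem Embeds.of_trees {l : ℕ} {Λ : α → Prop} {L L' : List (List ℕ × α)}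
    {T T' : List (ℕ × α × List (List ℕ × α))} (hL : IsForest l Λ L)
    (hT : (T.map Prod.fst).Nodup) (hTL : ∀ t, t ∈ T ↔ ([t.1], t.2.1) ∈ L ∧ t.2.2 = subforest t.1 L)
    (hT' : (T'.map Prod.fst).Nodup)
    (hTL' : ∀ t, t ∈ T' ↔ ([t.1], t.2.1) ∈ L' ∧ t.2.2 = subforest t.1 L')
    (h : List.SublistForall₂ TreeEmbeds T T') : Embeds L L' := by
  obtain ⟨g, h1, h2⟩ := h.exists_injection hT hT'
  have hroot : ∀ n a, ([n], a) ∈ L → ([g n], a) ∈ L' ∧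
      Embeds (subforest n L) (subforest (g n) L') := by
    intro n a hn
    obtain ⟨⟨n', b, M⟩, ht', h3, h4, h5⟩ := h1 (n, a, subforest n L) ((hTL _).2 ⟨hn, rfl⟩)
    obtain ⟨h6, h7⟩ := (hTL' _).1 ht'
    dsimp only at h3 h4 h5 h6 h7
    subst h3 h4 h7
    exact ⟨h6, h5⟩
  have hinj : ∀ n a n' a', ([n], a) ∈ L → ([n'], a') ∈ L → g n = g n' → n = n' :=
    fun n a n' a' hn hn' hg => h2 (n, a, subforest n L) ((hTL _).2 ⟨hn, rfl⟩)
      (n', a', subforest n' L) ((hTL _).2 ⟨hn', rfl⟩) hg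
  have hex : ∀ n, ∃ ψ : List ℕ → List ℕ, (∃ a, ([n], a) ∈ L) →
      (∀ e ∈ subforest n L, (ψ e.1).length = e.1.length ∧ (ψ e.1, e.2) ∈ subforest (g n) L') ∧
      ∀ e ∈ subforest n L, ∀ e' ∈ subforest n L, (e.1 <+: e'.1 ↔ ψ e.1 <+: ψ e'.1) := by
    intro n
    by_cases hn : ∃ a, ([n], a) ∈ L
    · obtain ⟨a, ha⟩ := hn
      obtain ⟨ψ, h⟩ := (hroot n a ha).2
      exact ⟨ψ, fun _ => h⟩
    · exact ⟨id, fun h => absurd h hn⟩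
  choose ψ hψ using hex
  let χ : List ℕ → List ℕ := fun p => match p with
    | [] => []
    | n :: p => g n :: if p = [] then [] else ψ n p
  refine ⟨χ, ?_, ?_⟩
  · rintro ⟨p, a⟩ he
    cases p with
    | nil => exact absurd rfl (hL.ne _ he)
    | cons n p =>
      by_cases hp : p = []
      · subst hp
        simpa [χ] using (hroot n a he).1
      · obtain ⟨h3, h4⟩ := (hψ n (hL.exists_root he)).1 (p, a) (mem_subforest.2 ⟨hp, he⟩)
        simpa [χ, hp, h3] using (mem_subforest.1 h4).2
  · rintro ⟨p, a⟩ he ⟨p', a'⟩ he'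
    cases p with
    | nil => exact absurd rfl (hL.ne _ he)
    | cons n p =>
    cases p' with
    | nil => exact absurd rfl (hL.ne _ he')
    | cons n' p' =>
      obtain ⟨b, hb⟩ := hL.exists_root he
      obtain ⟨b', hb'⟩ := hL.exists_root he'
      have hgn : g n = g n' ↔ n = n' := ⟨hinj n b n' b' hb hb', fun h => h ▸ rfl⟩
      simp only [χ, List.cons_prefix_cons, hgn]
      refine and_congr_right fun hnn => ?_
      subst hnn
      by_cases hp : p = []
      · simp [hp]
      · have h3 := (hψ n ⟨b, hb⟩).1 (p, a) (mem_subforest.2 ⟨hp, he⟩)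
        by_cases hp' : p' = []
        · have h4 : ψ n p ≠ [] := fun h0 => by
            have h5 := h3.1
            simp only [h0, List.length_nil] at h5
            exact hp (List.length_eq_zero_iff.1 h5.symm)
          simp [hp, hp', h4]
        · simpa [hp, hp'] using (hψ n ⟨b, hb⟩).2 (p, a) (mem_subforest.2 ⟨hp, he⟩)
            (p', a') (mem_subforest.2 ⟨hp', he'⟩)

/-- Labelled forests of bounded depth with finitely many labels are well-quasi-ordered. -/
theorem partiallyWellOrderedOn_isForest {Λ : α → Prop} (hΛ : {a | Λ a}.Finite) (l : ℕ) :
    {L | IsForest l Λ L}.PartiallyWellOrderedOn Embeds := by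
  induction l with
  | zero =>
    refine Set.PartiallyWellOrderedOn.mono (t := {[]}) (Set.partiallyWellOrderedOn_singleton _) ?_
    intro L hL
    rcases L with _ | ⟨e, L⟩
    · rfl
    · have h1 := hL.ne e (by simp)
      have h2 := hL.len e (by simp)
      exact absurd (List.length_eq_zero_iff.1 (Nat.le_zero.1 h2)) h1
  | succ l ih =>
    have htree : {t : ℕ × α × List (List ℕ × α) | Λ t.2.1 ∧ IsForest l Λ t.2.2}
        |>.PartiallyWellOrderedOn TreeEmbeds := by
      -- Root labels are compared by equality on a finite set, and the forests below by the
      -- induction hypothesis; the root index does not enter the order.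
      have h1 := (hΛ.partiallyWellOrderedOn (r := Eq)).prod ih
      rw [Set.partiallyWellOrderedOn_iff_exists_lt] at h1 ⊢
      intro f hf
      exact h1 (fun n => (f n).2) fun n => hf n
    -- Higman's lemma.
    have hlist := htree.partiallyWellOrderedOn_sublistForall₂ TreeEmbeds
    rw [Set.partiallyWellOrderedOn_iff_exists_lt] at hlist ⊢
    intro f hf
    choose T hT hTL using fun n => (hf n).exists_trees
    obtain ⟨m, n, hmn, h⟩ := hlist T fun n t ht => by
      obtain ⟨h1, h2⟩ := (hTL n t).1 ht
      exact ⟨(hf n).lab _ h1, h2 ▸ (hf n).subforest _⟩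
    exact ⟨m, n, hmn, Embeds.of_trees (hf m) (hT m) (hTL m) (hT n) (hTL n) h⟩

/-- A set of which no infinite sequence is bad has a finite basis. -/
theorem Set.PartiallyWellOrderedOn.exists_finset_basis {β : Type*} {r : β → β → Prop} {s : Set β}
    (h : s.PartiallyWellOrderedOn r) :
    ∃ U : Finset β, (∀ u ∈ U, u ∈ s) ∧ ∀ w ∈ s, ∃ u ∈ U, r u w := by
  by_contra hcon
  push Not at hcon
  -- Without a finite basis one can always pick a further element that lies above none of those
  -- chosen so far, which builds a bad sequence.
  obtain ⟨f, hf, hbad⟩ := exists_seq_of_forall_finset_exists (· ∈ s) (fun u w => ¬ r u w) hcon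
  obtain ⟨m, n, hmn, hr⟩ := h.exists_lt hf
  exact hbad m n hmn hr

end WellQuasiOrder

/-! ### Backward search and certificates for the product system. -/

section Decision

variable {X : Type v}

/-- The transition system of memories over the branches in `V`. -/
def TreeStep {α : Type} (V : Set (List X)) (R : α → List (Option α) → α → Prop)
    (c c' : α × (List X → Option α)) : Prop :=
  ∃ x ∈ V, R c.1 (trace c.2 x) c'.1 ∧ c'.2 = writePath c.2 c'.1 x

theorem isMemory_of_reflTransGen {α : Type} {l : ℕ} {V : Set (List X)} {Λ : α → Prop}
    {R : α → List (Option α) → α → Prop} (hV : IsFullTree l V)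
    (hR : ∀ q m q', R q m q' → Λ q') {c c' : α × (List X → Option α)}
    (h : Relation.ReflTransGen (TreeStep V R) c c') (hc : Λ c.1 ∧ IsMemory V Λ c.2) :
    Λ c'.1 ∧ IsMemory V Λ c'.2 := by
  induction h with
  | refl => exact hc
  | tail _ h ih =>
    obtain ⟨x, hx, hr, hw⟩ := h
    exact ⟨hR _ _ _ hr, hw ▸ ih.2.writePath hV hx (hR _ _ _ hr)⟩

theorem Realizes.eq_nil {α : Type} {L : List (List ℕ × α)}
    (h : Realizes (fun _ : List X => none) L) : L = [] := by
  obtain ⟨φ, h, -⟩ := h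
  exact List.eq_nil_iff_forall_not_mem.2 fun e he => by simpa using (h e he).2

theorem Realizes.nil {α : Type} (f : List X → Option α) : Realizes f [] :=
  ⟨fun _ => [], by simp, by simp⟩

/-- All words of length `n` over the alphabet `σ`. -/
def wordsOfLength {β : Type} (σ : List β) (n : ℕ) : List (List β) :=
  Nat.rec [[]] (fun _ W => W.flatMap fun w => σ.map fun a => a :: w) n

theorem mem_wordsOfLength {β : Type} {σ : List β} {n : ℕ} {w : List β} :
    w ∈ wordsOfLength σ n ↔ w.length = n ∧ ∀ a ∈ w, a ∈ σ := by
  induction n generalizing w with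
  | zero => simp +contextual [wordsOfLength]
  | succ n ih =>
    change (w ∈ (wordsOfLength σ n).flatMap fun w => σ.map fun a => a :: w) ↔ _
    simp only [List.mem_flatMap, List.mem_map, ih]
    constructor
    · rintro ⟨w, ⟨rfl, h⟩, a, ha, rfl⟩
      simpa [ha] using h
    · rintro ⟨h1, h2⟩
      cases w with
      | nil => simp at h1
      | cons a w =>
        exact ⟨w, ⟨by simpa using h1, fun b hb => h2 b (by simp [hb])⟩, a, h2 a (by simp), rfl⟩

/-- All tuples of at most `l` remembered states from `σ`. -/
def tuplesUpTo {β : Type} (σ : List β) (l : ℕ) : List (List (Option β)) :=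
  (List.range (l + 1)).flatMap fun n => wordsOfLength (none :: σ.map some) n

theorem mem_tuplesUpTo {β : Type} {σ : List β} {l : ℕ} {m : List (Option β)} :
    m ∈ tuplesUpTo σ l ↔ m.length ≤ l ∧ ∀ a, some a ∈ m → a ∈ σ := by
  simp only [tuplesUpTo, List.mem_flatMap, List.mem_range, mem_wordsOfLength]
  constructor
  · rintro ⟨n, h1, rfl, h2⟩
    exact ⟨by omega, fun a ha => by simpa using h2 _ ha⟩
  · rintro ⟨h1, h2⟩
    refine ⟨m.length, by omega, rfl, fun a ha => ?_⟩
    cases a with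
    | none => simp
    | some a => simpa using h2 a ha

/-- Stands for all product configurations with the given pair of states whose memory realizes the
given forest. -/
abbrev SymbolicConfig : Type := (ℕ × ℕ) × List (List ℕ × (ℕ × ℕ))

namespace NDCMACode

abbrev letters (c : NDCMACode) : ℕ := c.1
abbrev states (c : NDCMACode) : ℕ := c.2.1
abbrev start (c : NDCMACode) : ℕ := c.2.2.1
abbrev table (c : NDCMACode) : List (ℕ × ℕ × List (Option ℕ) × ℕ) := c.2.2.2.1
abbrev locals (c : NDCMACode) : List ℕ := c.2.2.2.2.1
abbrev globals (c : NDCMACode) : List ℕ := c.2.2.2.2.2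

/-- The states of the product automaton. -/
def Label (c₁ c₂ : NDCMACode) (q : ℕ × ℕ) : Prop :=
  q.1 < c₁.states ∧ q.2 < c₂.states

def labels (c₁ c₂ : NDCMACode) : List (ℕ × ℕ) :=
  (List.range c₁.states).flatMap fun i => (List.range c₂.states).map fun j => (i, j)

theorem mem_labels {c₁ c₂ : NDCMACode} {q : ℕ × ℕ} : q ∈ labels c₁ c₂ ↔ Label c₁ c₂ q := by
  obtain ⟨i, j⟩ := q
  simp [labels, Label]

/-- The transitions of the product automaton, without the letters. -/
def Rule (c₁ c₂ : NDCMACode) (q : ℕ × ℕ) (m : List (Option (ℕ × ℕ))) (q' : ℕ × ℕ) : Prop :=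
  ∃ a < c₁.letters, (q.1, a, m.map (Option.map Prod.fst), q'.1) ∈ c₁.table ∧
    (q.2, a, m.map (Option.map Prod.snd), q'.2) ∈ c₂.table

/-- The code describes a deterministic weak automaton of level `l`. -/
def Valid (l : ℕ) (c : NDCMACode) : Prop :=
  c.start < c.states ∧
  (∀ t ∈ c.table, t.1 < c.states ∧ t.2.1 < c.letters ∧ t.2.2.1 ≠ [] ∧
    t.2.2.1 ∈ tuplesUpTo (List.range c.states) l ∧ t.2.2.2 < c.states) ∧
  (∀ q < c.states, ∀ a < c.letters, ∀ m ∈ tuplesUpTo (List.range c.states) l, m ≠ [] →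
    ∃ q' < c.states, ∀ r < c.states, ((q, a, m, r) ∈ c.table ↔ r = q')) ∧
  (∀ s ∈ c.locals, s < c.states) ∧ (∀ s < c.states, s ∈ c.locals) ∧
  ∀ s ∈ c.globals, s < c.states

/-- The symbolic predecessors along one path. -/
def PredVia (l : ℕ) (c₁ c₂ : NDCMACode) (q q' : ℕ × ℕ) (m : List (Option (ℕ × ℕ))) (y : List ℕ)
    (L : List (List ℕ × (ℕ × ℕ))) : Prop :=
  Rule c₁ c₂ q m q' ∧ (∀ e ∈ L, e.1 <+: y → e.2 = q') ∧
    IsForest l (Label c₁ c₂) (unwrite m y L)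

open Classical in
noncomputable def preds (l : ℕ) (c₁ c₂ : NDCMACode) (u : SymbolicConfig) : List SymbolicConfig :=
  (labels c₁ c₂).flatMap fun q => (tuplesUpTo (labels c₁ c₂) l).flatMap fun m =>
    ([] :: u.2.map Prod.fst).filterMap fun v =>
      if PredVia l c₁ c₂ q u.1 m (extendPath v m.length (freshIndex u.2)) u.2 then
        some (q, unwrite m (extendPath v m.length (freshIndex u.2)) u.2) else none

theorem mem_preds {l : ℕ} {c₁ c₂ : NDCMACode} {u w : SymbolicConfig} :
    w ∈ preds l c₁ c₂ u ↔ ∃ q m v, Label c₁ c₂ q ∧ m ∈ tuplesUpTo (labels c₁ c₂) l ∧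
      (v = [] ∨ ∃ e ∈ u.2, v = e.1) ∧
      PredVia l c₁ c₂ q u.1 m (extendPath v m.length (freshIndex u.2)) u.2 ∧
      w = (q, unwrite m (extendPath v m.length (freshIndex u.2)) u.2) := by
  simp only [preds, List.mem_flatMap, List.mem_filterMap, Option.ite_none_right_eq_some,
    Option.some.injEq, mem_labels, List.mem_cons, List.mem_map]
  constructor
  · rintro ⟨q, hq, m, hm, v, hv, hP, rfl⟩
    exact ⟨q, m, v, hq, hm, by simpa [eq_comm] using hv, hP, rfl⟩
  · rintro ⟨q, m, v, hq, hm, hv, hP, rfl⟩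
    exact ⟨q, hq, m, hm, v, by simpa [eq_comm] using hv, hP, rfl⟩

open Classical in
/-- The product configurations that show that containment fails. -/
noncomputable def bads (c₁ c₂ : NDCMACode) : List SymbolicConfig :=
  ((labels c₁ c₂).filter fun q => q.1 ∈ c₁.globals ∧ q.2 ∉ c₂.globals).map fun q => (q, [])

theorem mem_bads {c₁ c₂ : NDCMACode} {u : SymbolicConfig} :
    u ∈ bads c₁ c₂ ↔ Label c₁ c₂ u.1 ∧ u.1.1 ∈ c₁.globals ∧ u.1.2 ∉ c₂.globals ∧ u.2 = [] := by
  obtain ⟨q, L⟩ := u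
  simp only [bads, List.mem_map, List.mem_filter, mem_labels, decide_eq_true_eq, Prod.mk.injEq]
  constructor
  · rintro ⟨q', ⟨h1, h2, h3⟩, rfl, rfl⟩
    exact ⟨h1, h2, h3, rfl⟩
  · rintro ⟨h1, h2, h3, rfl⟩
    exact ⟨q, ⟨h1, h2, h3⟩, rfl, rfl⟩

/-- The symbolic configurations found in round `k` of the backward search. -/
noncomputable def backward (l : ℕ) (c₁ c₂ : NDCMACode) (k : ℕ) : List SymbolicConfig :=
  (fun U => U.flatMap (preds l c₁ c₂))^[k] (bads c₁ c₂)

theorem mem_backward_succ {l : ℕ} {c₁ c₂ : NDCMACode} {k : ℕ} {w : SymbolicConfig} :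
    w ∈ backward l c₁ c₂ (k + 1) ↔ ∃ u ∈ backward l c₁ c₂ k, w ∈ preds l c₁ c₂ u := by
  simp [backward, Function.iterate_succ_apply']

def startConfig (c₁ c₂ : NDCMACode) : SymbolicConfig := ((c₁.start, c₂.start), [])

/-- The backward search from the bad configurations reaches the initial configuration. -/
def Refuted (l : ℕ) (c₁ c₂ : NDCMACode) : Prop :=
  ∃ k, startConfig c₁ c₂ ∈ backward l c₁ c₂ k

/-- The finite list `ψ` is the graph of an embedding of `L` into `M`. -/
def EmbedsVia (ψ : List (List ℕ × List ℕ)) (L M : List (List ℕ × (ℕ × ℕ))) : Prop :=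
  (∀ e ∈ L, ∃ r ∈ ψ, r.1 = e.1 ∧ (r.2, e.2) ∈ M) ∧
  ∀ r ∈ ψ, r.2.length = r.1.length ∧ ∀ s ∈ ψ, (r.1 <+: s.1 ↔ r.2 <+: s.2)

/-- Preservation of prefixes and of lengths makes the relation `ψ` single-valued: equal sources have
targets that are prefixes of each other and of the same length. -/
theorem EmbedsVia.embeds {ψ : List (List ℕ × List ℕ)} {L M : List (List ℕ × (ℕ × ℕ))}
    (h : EmbedsVia ψ L M) : Embeds L M := by
  classical
  obtain ⟨h1, h2⟩ := h
  choose! g hg using h1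
  have huniq : ∀ r ∈ ψ, ∀ s ∈ ψ, r.1 = s.1 → r.2 = s.2 := fun r hr s hs hrs =>
    (((h2 r hr).2 s hs).1 (hrs ▸ List.prefix_rfl)).eq_of_length
      (by rw [(h2 r hr).1, (h2 s hs).1, hrs])
  let χ : List ℕ → List ℕ := fun p => if h : ∃ r ∈ ψ, r.1 = p then h.choose.2 else []
  have hχ : ∀ e ∈ L, χ e.1 = (g e).2 := fun e he => by
    have hex : ∃ r ∈ ψ, r.1 = e.1 := ⟨g e, (hg e he).1, (hg e he).2.1⟩
    simp only [χ, hex, dif_pos]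
    exact huniq _ hex.choose_spec.1 _ (hg e he).1
      (hex.choose_spec.2.trans (hg e he).2.1.symm)
  refine ⟨χ, fun e he => ?_, fun e he e' he' => ?_⟩
  · rw [hχ e he]
    obtain ⟨h3, h4, h5⟩ := hg e he
    exact ⟨by rw [(h2 _ h3).1, h4], h5⟩
  · rw [hχ e he, hχ e' he', ← (h2 _ (hg e he).1).2 _ (hg e' he').1, (hg e he).2.1,
      (hg e' he').2.1]

theorem exists_embedsVia {L M : List (List ℕ × (ℕ × ℕ))} (h : Embeds L M) :
    ∃ ψ, EmbedsVia ψ L M := by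
  obtain ⟨ψ, h1, h2⟩ := h
  refine ⟨L.map fun e => (e.1, ψ e.1), fun e he => ?_, fun r hr => ?_⟩
  · exact ⟨(e.1, ψ e.1), List.mem_map.2 ⟨e, he, rfl⟩, rfl, (h1 e he).2⟩
  · obtain ⟨e, he, rfl⟩ := List.mem_map.1 hr
    refine ⟨(h1 e he).1, fun s hs => ?_⟩
    obtain ⟨e', he', rfl⟩ := List.mem_map.1 hs
    exact h2 e he e' he'

/-- A finite basis of an upward closed set that contains all bad configurations, is closed under
predecessors and does not contain the initial configuration. -/
def Certificate (l : ℕ) (c₁ c₂ : NDCMACode) (U : List SymbolicConfig)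
    (Ψ : List (List (List ℕ × List ℕ))) : Prop :=
  (∀ w ∈ bads c₁ c₂ ++ U.flatMap (preds l c₁ c₂),
    ∃ u ∈ U, u.1 = w.1 ∧ ∃ ψ ∈ Ψ, EmbedsVia ψ u.2 w.2) ∧
  (∀ u ∈ U, IsForest l (Label c₁ c₂) u.2) ∧ startConfig c₁ c₂ ∉ U

/-- The product system has a run to a bad configuration. -/
def BadRun (V : Set (List X)) (c₁ c₂ : NDCMACode) : Prop :=
  ∃ c, Relation.ReflTransGen (TreeStep V (Rule c₁ c₂))
    ((c₁.start, c₂.start), fun _ => none) c ∧ c.1.1 ∈ c₁.globals ∧ c.1.2 ∉ c₂.globals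

theorem Valid.label_of_rule {l : ℕ} {c₁ c₂ : NDCMACode} (h₁ : Valid l c₁) (h₂ : Valid l c₂) :
    ∀ q m q', Rule c₁ c₂ q m q' → Label c₁ c₂ q' := by
  rintro q m q' ⟨a, -, h, h'⟩
  exact ⟨(h₁.2.1 _ h).2.2.2.2, (h₂.2.1 _ h').2.2.2.2⟩

/-- The upward closure of `U` contains the end of a bad run and is closed under predecessors, so
following the run backwards puts the initial configuration into it. -/
theorem not_badRun_of_certificate {l : ℕ} {V : Set (List X)} (hV : IsFullTree l V)
    {c₁ c₂ : NDCMACode} (h₁ : Valid l c₁) (h₂ : Valid l c₂) {U : List SymbolicConfig}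
    {Ψ : List (List (List ℕ × List ℕ))} (h : Certificate l c₁ c₂ U Ψ) : ¬ BadRun V c₁ c₂ := by
  rintro ⟨c, hrun, hc1, hc2⟩
  obtain ⟨hcov, hfor, hstart⟩ := h
  have hR := h₁.label_of_rule h₂
  have hinit : Label c₁ c₂ (c₁.start, c₂.start) ∧
      IsMemory V (Label c₁ c₂) (fun _ => none) := ⟨⟨h₁.1, h₂.1⟩, IsMemory.empty _ _⟩
  have hcover : ∀ w ∈ bads c₁ c₂ ++ U.flatMap (preds l c₁ c₂), ∀ f : List X → Option (ℕ × ℕ),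
      Realizes f w.2 → ∃ u ∈ U, u.1 = w.1 ∧ Realizes f u.2 := by
    intro w hw f hf
    obtain ⟨u, hu, huw, ψ, -, hψ⟩ := hcov w hw
    exact ⟨u, hu, huw, hf.of_embeds hψ.embeds⟩
  have hback : ∃ u ∈ U, u.1 = (c₁.start, c₂.start) ∧
      Realizes (fun _ : List X => none) u.2 := by
    -- Every memory realizes the empty forest, so only the pair of states matters at the end of the
    -- run.
    have hlast : ∃ u ∈ U, u.1 = c.1 ∧ Realizes c.2 u.2 :=
      hcover (c.1, []) (List.mem_append_left _ (mem_bads.2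
        ⟨(isMemory_of_reflTransGen hV hR hrun hinit).1, hc1, hc2, rfl⟩)) _ (Realizes.nil _)
    clear hc1 hc2
    induction hrun with
    | refl => exact hlast
    | @tail c c' hrun hstep ih =>
      obtain ⟨x, hx, hr, hw⟩ := hstep
      obtain ⟨hq, hf⟩ := isMemory_of_reflTransGen hV hR hrun hinit
      obtain ⟨u, hu, huc, hreal⟩ := hlast
      rw [hw] at hreal
      obtain ⟨v, hv, h3, h4, h5⟩ := exists_realizes_unwrite hV hf (hfor u hu) hx hreal
      refine ih (hcover (c.1, unwrite (trace c.2 x)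
        (extendPath v x.length (freshIndex u.2)) u.2) (List.mem_append_right _
        (List.mem_flatMap.2 ⟨u, hu, mem_preds.2 ⟨c.1, trace c.2 x, v, hq, ?_, hv, ?_, ?_⟩⟩)) _ h5)
      · refine mem_tuplesUpTo.2 ⟨by rw [trace_length]; exact hV.len x hx, fun a ha => ?_⟩
        obtain ⟨k, -, hk⟩ := List.mem_map.1 ha
        exact mem_labels.2 (hf.lab _ _ hk)
      · rw [trace_length]
        exact ⟨huc ▸ hr, fun e he hey => (h3 e he hey).trans huc.symm, h4⟩
      · rw [trace_length]
  obtain ⟨⟨q, L⟩, hu, rfl, hreal⟩ := hback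
  -- The empty memory realizes no forest but the empty one, so literal absence of the initial
  -- configuration from `U` is enough for a contradiction.
  obtain rfl : L = [] := hreal.eq_nil
  exact hstart hu

/-- Each round of the search can be undone by one concrete step, so a memory realizing a forest
found in round `k` leads to a bad configuration. -/
theorem badRun_of_refuted {l : ℕ} {V : Set (List X)} (hV : IsFullTree l V)
    {c₁ c₂ : NDCMACode} (h₁ : Valid l c₁) (h₂ : Valid l c₂) (h : Refuted l c₁ c₂) :
    BadRun V c₁ c₂ := by
  obtain ⟨k, hk⟩ := h
  have hR := h₁.label_of_rule h₂
  have key : ∀ k, ∀ w ∈ backward l c₁ c₂ k, (∀ e ∈ w.2, e.1 ≠ []) ∧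
      ∀ f : List X → Option (ℕ × ℕ), IsMemory V (Label c₁ c₂) f → Realizes f w.2 →
      ∃ c, Relation.ReflTransGen (TreeStep V (Rule c₁ c₂)) (w.1, f) c ∧
        c.1.1 ∈ c₁.globals ∧ c.1.2 ∉ c₂.globals := by
    intro k
    induction k with
    | zero =>
      intro w hw
      obtain ⟨h1, h2, h3, h4⟩ := mem_bads.1 hw
      exact ⟨by simp [h4], fun f hf _ => ⟨(w.1, f), .refl, h2, h3⟩⟩
    | succ k ih =>
      intro w hw
      obtain ⟨u, hu, hwu⟩ := mem_backward_succ.1 hw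
      obtain ⟨q, m, v, hq, hm, -, ⟨hP1, hP2, hP3⟩, rfl⟩ := mem_preds.1 hwu
      refine ⟨hP3.ne, fun f hf hreal => ?_⟩
      obtain ⟨x, hx, hxm, hreal'⟩ := exists_writePath_realizes hV hf (extendPath_length _ _ _)
        (mem_tuplesUpTo.1 hm).1 hP2 (ih u hu).1 hP3 hreal
      obtain ⟨c, hc, hc'⟩ := (ih u hu).2 _ (hf.writePath hV hx (hR _ _ _ hP1)) hreal'
      exact ⟨c, .head ⟨x, hx, hxm ▸ hP1, rfl⟩ hc, hc'⟩
  exact (key k _ hk).2 _ (IsMemory.empty _ _) (Realizes.nil _)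

/-- A finite basis of everything the search ever finds will do. Predecessors of basis elements are
found as well, hence they lie above some basis element. -/
theorem exists_certificate {l : ℕ} {c₁ c₂ : NDCMACode} (h : ¬ Refuted l c₁ c₂) :
    ∃ U Ψ, Certificate l c₁ c₂ U Ψ := by
  classical
  let S : Set SymbolicConfig := {w | ∃ k, w ∈ backward l c₁ c₂ k}
  have hS : ∀ w ∈ S, Label c₁ c₂ w.1 ∧ IsForest l (Label c₁ c₂) w.2 := by
    rintro w ⟨k, hk⟩
    cases k with
    | zero =>
      obtain ⟨h1, -, -, h2⟩ := mem_bads.1 hk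
      exact ⟨h1, h2 ▸ IsForest.nil _ _⟩
    | succ k =>
      obtain ⟨u, hu, hwu⟩ := mem_backward_succ.1 hk
      obtain ⟨q, m, v, hq, hm, -, hP, rfl⟩ := mem_preds.1 hwu
      exact ⟨hq, hP.2.2⟩
  have hfin : {q | Label c₁ c₂ q}.Finite :=
    (List.finite_toSet (labels c₁ c₂)).subset fun q hq => mem_labels.2 hq
  have hpwo : S.PartiallyWellOrderedOn fun u w => u.1 = w.1 ∧ Embeds u.2 w.2 :=
    ((hfin.partiallyWellOrderedOn (r := Eq)).prod
      (partiallyWellOrderedOn_isForest hfin l)).mono fun w hw => hS w hw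
  obtain ⟨U, hUS, hU⟩ := hpwo.exists_finset_basis
  have hZ : ∀ w ∈ bads c₁ c₂ ++ U.toList.flatMap (preds l c₁ c₂), w ∈ S := by
    intro w hw
    rcases List.mem_append.1 hw with hw | hw
    · exact ⟨0, hw⟩
    · obtain ⟨u, hu, hwu⟩ := List.mem_flatMap.1 hw
      obtain ⟨k, hk⟩ := hUS u (Finset.mem_toList.1 hu)
      exact ⟨k + 1, mem_backward_succ.2 ⟨u, hk, hwu⟩⟩
  -- One witnessing embedding per symbolic configuration. The certificate needs only those for the
  -- bad configurations and the predecessors of `U`, of which there are finitely many.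
  have hψ : ∀ w, ∃ ψ, w ∈ S → ∃ u ∈ U, u.1 = w.1 ∧ EmbedsVia ψ u.2 w.2 := by
    intro w
    by_cases hw : w ∈ S
    · obtain ⟨u, hu, h1, h2⟩ := hU w hw
      obtain ⟨ψ, hψ⟩ := exists_embedsVia h2
      exact ⟨ψ, fun _ => ⟨u, hu, h1, hψ⟩⟩
    · exact ⟨[], fun h => absurd h hw⟩
  choose ψ hψ using hψ
  refine ⟨U.toList, (bads c₁ c₂ ++ U.toList.flatMap (preds l c₁ c₂)).map ψ, fun w hw => ?_,
    fun u hu => (hS u (hUS u (Finset.mem_toList.1 hu))).2,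
    fun hu => h (hUS _ (Finset.mem_toList.1 hu))⟩
  obtain ⟨u, hu, h1, h2⟩ := hψ w (hZ w hw)
  exact ⟨u, Finset.mem_toList.2 hu, h1, ψ w, List.mem_map.2 ⟨w, hw, rfl⟩, h2⟩

theorem isFullTree_nat (l : ℕ) : IsFullTree l {x : List ℕ | x.length ≤ l} where
  nil_mem := by simp
  len x hx := hx
  closed x hx p hp := hp.length_le.trans hx
  full x _ hx := by
    have : {d : ℕ | x ++ [d] ∈ {x : List ℕ | x.length ≤ l}} = Set.univ := by
      ext d
      simp
      omega
    rw [this]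
    exact Set.infinite_univ

/-- Neither side involves a data set, so their incompatibility may be checked on one concrete full
tree: a successful search gives a bad run there, and a certificate forbids it. -/
theorem not_refuted_iff {l : ℕ} {c₁ c₂ : NDCMACode} (h₁ : Valid l c₁) (h₂ : Valid l c₂) :
    ¬ Refuted l c₁ c₂ ↔ ∃ U Ψ, Certificate l c₁ c₂ U Ψ :=
  ⟨exists_certificate, fun ⟨_, _, h⟩ hr =>
    not_badRun_of_certificate (isFullTree_nat l) h₁ h₂ h
      (badRun_of_refuted (isFullTree_nat l) h₁ h₂ hr)⟩

theorem badRun_iff_refuted {l : ℕ} {V : Set (List X)} (hV : IsFullTree l V)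
    {c₁ c₂ : NDCMACode} (h₁ : Valid l c₁) (h₂ : Valid l c₂) :
    BadRun V c₁ c₂ ↔ Refuted l c₁ c₂ := by
  refine ⟨fun h => ?_, badRun_of_refuted hV h₁ h₂⟩
  by_contra hr
  obtain ⟨U, Ψ, hc⟩ := exists_certificate hr
  exact not_badRun_of_certificate hV h₁ h₂ hc h

end NDCMACode

end Decision

/-! ### From automata on nested data sets to the product system on branches. -/

section Automata

variable {D : Type v} {l : ℕ}

/-- The branches of a forest, listed from the root down, together with the empty list. -/
def branches (pred : D → Option D) : Set (List D) :=
  {x | (∀ d, x[0]? = some d → pred d = none) ∧ ∀ k d, x[k + 1]? = some d → pred d = x[k]?}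

theorem isBranch_iff {pred : D → Option D} {i : ℕ} {x : Fin (i + 1) → D} :
    IsBranch pred x ↔ List.ofFn x ∈ branches pred := by
  simp only [IsBranch, branches, Set.mem_ofPred_eq, List.getElem?_ofFn]
  refine and_congr ?_ ⟨fun h k d hd => ?_, fun h j => ?_⟩
  · simp
  · by_cases hk : k + 1 < i + 1
    · simp only [hk, dif_pos, Option.some.injEq] at hd
      rw [dif_pos (by omega), ← hd]
      exact h ⟨k, by omega⟩
    · simp [hk] at hd
  · have := h j (x j.succ) (by rw [dif_pos (by omega)]; rfl)
    rw [this, dif_pos (by omega)]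
    rfl

theorem exists_eq_ofFn {x : List D} (h : x ≠ []) :
    ∃ (i : ℕ) (y : Fin (i + 1) → D), x = List.ofFn y := by
  cases x with
  | nil => exact absurd rfl h
  | cons d x => exact ⟨x.length, (d :: x).get, (List.ofFn_get _).symm⟩

/-- Predecessors are unique, so two branches through a common node agree from there up to the root.
This makes memories on nodes and memories on branches interchangeable. -/
theorem branches_take {pred : D → Option D} {x : List D} (hx : x ∈ branches pred) {z : List D}
    (hz : z ∈ branches pred) {i j : ℕ} {d : D} (hi : x[i]? = some d) (hj : z[j]? = some d) :
    i = j ∧ x.take (i + 1) = z.take (j + 1) := by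
  induction i generalizing j d with
  | zero =>
    cases j with
    | zero => exact ⟨rfl, by simp [List.take_add_one, hi, hj]⟩
    | succ j =>
      have h1 := hx.1 d hi
      rw [hz.2 j d hj] at h1
      have := (List.getElem?_eq_some_iff.1 hj).1
      have := List.getElem?_eq_none_iff.1 h1
      omega
  | succ i ih =>
    cases j with
    | zero =>
      have h1 := hz.1 d hj
      rw [hx.2 i d hi] at h1
      have := (List.getElem?_eq_some_iff.1 hi).1
      have := List.getElem?_eq_none_iff.1 h1
      omega
    | succ j =>
      have h1 := hx.2 i d hi
      have h2 := hz.2 j d hj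
      have h3 := (List.getElem?_eq_some_iff.1 hi).1
      have h4 : x[i]? = some x[i] := List.getElem?_eq_getElem (by omega)
      obtain ⟨rfl, h5⟩ := ih h4 (j := j) (by rw [← h2, h1, h4])
      refine ⟨rfl, ?_⟩
      rw [List.take_add_one (i := i + 1), List.take_add_one (i := i + 1), h5, hi, hj]

theorem branches_ext {pred : D → Option D} {x : List D} (hx : x ∈ branches pred) {z : List D}
    (hz : z ∈ branches pred) {d : D} (hxd : x.getLast? = some d) (hzd : z.getLast? = some d) :
    x = z := by
  rw [List.getLast?_eq_getElem?] at hxd hzd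
  obtain ⟨-, h⟩ := branches_take hx hz hxd hzd
  have h1 := (List.getElem?_eq_some_iff.1 hxd).1
  have h2 := (List.getElem?_eq_some_iff.1 hzd).1
  rwa [Nat.sub_add_cancel (by omega), Nat.sub_add_cancel (by omega), List.take_length,
    List.take_length] at h

theorem getLast?_ofFn {i : ℕ} (x : Fin (i + 1) → D) :
    (List.ofFn x).getLast? = some (x (Fin.last i)) := by
  rw [List.getLast?_eq_getElem?, List.getElem?_ofFn, List.length_ofFn, dif_pos (by omega)]
  rfl

theorem append_mem_branches {pred : D → Option D} {x : List D} (hx : x ∈ branches pred) {d : D} :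
    x ++ [d] ∈ branches pred ↔ pred d = x.getLast? := by
  rw [List.getLast?_eq_getElem?]
  constructor
  · intro h
    rcases x.length.eq_zero_or_pos with h0 | h0
    · obtain rfl := List.length_eq_zero_iff.1 h0
      simpa using h.1 d (by simp)
    · have := h.2 (x.length - 1) d (by rw [Nat.sub_add_cancel (by omega)]; simp)
      rwa [List.getElem?_append_left (by omega)] at this
  · intro h
    refine ⟨fun e he => ?_, fun k e he => ?_⟩
    · rcases x.length.eq_zero_or_pos with h0 | h0
      · obtain rfl := List.length_eq_zero_iff.1 h0
        simp at he h
        rw [← he, h]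
      · rw [List.getElem?_append_left (by omega)] at he
        exact hx.1 e he
    · rcases lt_trichotomy (k + 1) x.length with h0 | h0 | h0
      · rw [List.getElem?_append_left (by omega)] at he ⊢
        exact hx.2 k e he
      · rw [h0] at he
        simp at he
        subst he
        rw [List.getElem?_append_left (by omega), h]
        congr 1
        omega
      · rw [List.getElem?_eq_none (by simp; omega)] at he
        simp at he

theorem NestedDataset.isFullTree (N : NestedDataset D l) : IsFullTree l (branches N.pred) where
  nil_mem := by simp [branches]
  len x hx := by
    rcases hd : x.getLast? with _ | d
    · simp [List.getLast?_eq_none_iff.1 hd]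
    · obtain ⟨_, ⟨j, y, rfl, hy, rfl⟩, hj⟩ := N.bounded d
      rw [branches_ext hx (isBranch_iff.1 hy) hd (getLast?_ofFn y)]
      simpa using hj
  closed x hx p hp := by
    rw [List.prefix_iff_getElem?] at hp
    have hp' : ∀ k, k < p.length → p[k]? = x[k]? := fun k hk => by
      rw [hp k hk, List.getElem?_eq_getElem hk]
    refine ⟨fun d hd => ?_, fun k d hd => ?_⟩
    · have := (List.getElem?_eq_some_iff.1 hd).1
      exact hx.1 d (by rw [← hp' 0 this, hd])
    · have := (List.getElem?_eq_some_iff.1 hd).1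
      rw [hp' k (by omega)]
      exact hx.2 k d (by rw [← hp' _ this, hd])
  full x hx hxl := by
    simp only [append_mem_branches hx]
    rcases hd : x.getLast? with _ | d
    · exact N.infinite_roots
    · have hx0 : x ≠ [] := by rintro rfl; simp at hd
      obtain ⟨i, y, hy⟩ := exists_eq_ofFn hx0
      refine N.full d x.length ⟨i, y, by simp [hy], isBranch_iff.2 (hy ▸ hx), ?_⟩ hxl
      have := getLast?_ofFn y
      rw [← hy, hd] at this
      exact (Option.some.inj this).symm

namespace NDCMA

variable {Q S : Type} [Finite Q] [Finite S]

theorem exists_step {A : NDCMA Q S l} {N : NestedDataset D l} {c : NDCMAConfig Q D}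
    {i : Fin l} {x : Fin (i + 1) → D} (hx : IsBranch N.pred x) {a : S} {q : Q}
    (hq : q ∈ A.δ i c.state a fun j => c.mem (x j)) :
    ∃ c' : NDCMAConfig Q D, c'.state = q ∧ (∀ j, c'.mem (x j) = some q) ∧
      (∀ e, (∀ j, x j ≠ e) → c'.mem e = c.mem e) ∧ A.Step N c (a, x (Fin.last i)) c' := by
  classical
  let c' : NDCMAConfig Q D :=
    { state := q
      mem := fun e => if ∃ j, x j = e then some q else c.mem e
      finite_mem := by
        refine (c.finite_mem.union (Set.finite_range x)).subset fun e he => ?_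
        by_cases h : ∃ j, x j = e
        · exact Or.inr h
        · exact Or.inl (by simpa [h] using he) }
  have h1 : ∀ j, c'.mem (x j) = some q := fun j => if_pos ⟨j, rfl⟩
  have h2 : ∀ e, (∀ j, x j ≠ e) → c'.mem e = c.mem e := fun e he => if_neg (by simpa using he)
  exact ⟨c', rfl, h1, h2, i, x, hx, rfl, hq, h1, h2⟩

theorem Deterministic.step_unique {A : NDCMA Q S l} (hA : A.Deterministic)
    {N : NestedDataset D l} {c c₁ c₂ : NDCMAConfig Q D} {p : S × D} (h₁ : A.Step N c p c₁)
    (h₂ : A.Step N c p c₂) : c₁ = c₂ := by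
  obtain ⟨i, x, hx, hxp, hq, hm, ho⟩ := h₁
  obtain ⟨i', x', hx', hxp', hq', hm', ho'⟩ := h₂
  have heq := branches_ext (isBranch_iff.1 hx) (isBranch_iff.1 hx') (getLast?_ofFn x)
    (by rw [getLast?_ofFn, hxp, hxp'])
  have hii : i = i' := by
    have := congrArg List.length heq
    simp at this
    exact Fin.ext this
  subst hii
  have hxx := List.ofFn_injective heq
  subst hxx
  obtain ⟨q, hqq⟩ := hA i c.state p.1 fun j => c.mem (x j)
  rw [hqq, Set.mem_singleton_iff] at hq hq'
  have hmem : c₁.mem = c₂.mem := by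
    funext e
    by_cases h : ∃ j, x j = e
    · obtain ⟨j, rfl⟩ := h
      rw [hm, hm', hq, hq']
    · push Not at h
      rw [ho e h, ho' e h]
  cases c₁
  cases c₂
  simp_all

theorem Deterministic.run_unique {A : NDCMA Q S l} (hA : A.Deterministic)
    {N : NestedDataset D l} {c c₁ c₂ : NDCMAConfig Q D} {w : List (S × D)} (h₁ : A.Run N c w c₁)
    (h₂ : A.Run N c w c₂) : c₁ = c₂ := by
  induction h₁ with
  | nil c => cases h₂; rfl
  | cons hs _ ih =>
    cases h₂ with
    | cons hs' hr' =>
      obtain rfl := hA.step_unique hs hs'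
      exact ih hr'

end NDCMA

/-- The configuration `c` of an automaton is the image under `π` of a configuration of the
product system. -/
def Tracks {n : ℕ} (N : NestedDataset D l) (π : ℕ × ℕ → ℕ)
    (s : (ℕ × ℕ) × (List D → Option (ℕ × ℕ))) (c : NDCMAConfig (Fin n) D) : Prop :=
  π s.1 = c.state.val ∧ ∀ x ∈ branches N.pred, ∀ d, x.getLast? = some d →
    (s.2 x).map π = (c.mem d).map Fin.val

/-- The nonempty prefixes of a branch are exactly the branches that end in one of its nodes, so both
memories are overwritten at corresponding places. -/
theorem Tracks.write {n : ℕ} {N : NestedDataset D l} {π : ℕ × ℕ → ℕ}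
    {s : (ℕ × ℕ) × (List D → Option (ℕ × ℕ))} {c c' : NDCMAConfig (Fin n) D}
    (h : Tracks N π s c) {i : ℕ} {x : Fin (i + 1) → D} (hx : List.ofFn x ∈ branches N.pred)
    {q : ℕ × ℕ} (hq : π q = c'.state.val) (hm : ∀ j, c'.mem (x j) = some c'.state)
    (ho : ∀ e, (∀ j, x j ≠ e) → c'.mem e = c.mem e) :
    Tracks N π (q, writePath s.2 q (List.ofFn x)) c' := by
  refine ⟨hq, fun z hz d hd => ?_⟩
  by_cases hzx : z ≠ [] ∧ z <+: List.ofFn x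
  · simp only [writePath]
    rw [if_pos hzx]
    rw [List.getLast?_eq_getElem?] at hd
    have h1 := (List.getElem?_eq_some_iff.1 hd)
    obtain ⟨h2, h3⟩ := h1
    have h4 := List.prefix_iff_getElem?.1 hzx.2 _ h2
    rw [h3, List.getElem?_ofFn] at h4
    have h5 := hzx.2.length_le
    rw [List.length_ofFn] at h5
    rw [dif_pos (by omega), Option.some.injEq] at h4
    rw [← h4, hm]
    simp [hq]
  · simp only [writePath]
    rw [if_neg hzx, h.2 z hz d hd, ho d]
    intro j hj
    have hzne : z ≠ [] := by rintro rfl; simp at hd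
    refine hzx ⟨hzne, ?_⟩
    rw [List.getLast?_eq_getElem?] at hd
    have h1 : (List.ofFn x)[j.val]? = some d := by
      rw [List.getElem?_ofFn, dif_pos j.2]
      exact congrArg some hj
    obtain ⟨-, h2⟩ := branches_take hz hx hd h1
    have := List.length_pos_iff.2 hzne
    rw [Nat.sub_add_cancel (by omega), List.take_length] at h2
    rw [h2]
    exact List.take_prefix _ _

theorem Tracks.map_trace {n : ℕ} {N : NestedDataset D l} {π : ℕ × ℕ → ℕ}
    {s : (ℕ × ℕ) × (List D → Option (ℕ × ℕ))} {c : NDCMAConfig (Fin n) D}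
    (h : Tracks N π s c) {i : ℕ} {x : Fin (i + 1) → D} (hx : List.ofFn x ∈ branches N.pred) :
    (trace s.2 (List.ofFn x)).map (Option.map π) =
      List.ofFn fun j => (c.mem (x j)).map Fin.val := by
  refine List.ext_getElem (by simp [trace_length]) fun k h1 h2 => ?_
  simp only [trace, List.getElem_map, List.getElem_range, List.getElem_ofFn]
  simp only [List.length_ofFn] at h2
  refine h.2 _ (N.isFullTree.closed _ hx _ (List.take_prefix _ _)) _ ?_
  rw [List.getLast?_eq_getElem?, List.length_take, List.length_ofFn, min_eq_left (by omega),
    Nat.add_sub_cancel, List.getElem?_take_of_lt (by omega), List.getElem?_ofFn, dif_pos h2]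

theorem tracks_init {n k : ℕ} (N : NestedDataset D l) (π : ℕ × ℕ → ℕ)
    (A : NDCMA (Fin n) (Fin k) l) {q : ℕ × ℕ} (hq : π q = A.init.val) :
    Tracks N π (q, fun _ => none) (A.initConfig D) :=
  ⟨hq, fun _ _ _ _ => rfl⟩

namespace NDCMACode

theorem Describes.mem_table {n k : ℕ} {c : NDCMACode} {A : NDCMA (Fin n) (Fin k) l}
    (h : c.Describes A) {i : Fin l} {q : Fin n} {a : Fin k} {m : Fin (i + 1) → Option (Fin n)}
    {q' : Fin n} : (q.val, a.val, List.ofFn (fun j => (m j).map Fin.val), q'.val) ∈ c.table ↔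
      q' ∈ A.δ i q a m := by
  obtain ⟨-, -, -, ht, -, -⟩ := h
  refine (ht _).trans ⟨?_, fun h => ⟨i, q, a, m, q', h, rfl⟩⟩
  rintro ⟨i₁, q₁, a₁, m₁, q₁', h1, h2⟩
  simp only [Prod.mk.injEq] at h2
  obtain ⟨h2, h3, h4, h5⟩ := h2
  obtain rfl := Fin.ext h2
  obtain rfl := Fin.ext h3
  obtain rfl := Fin.ext h5
  have hi : i = i₁ := by
    have := congrArg List.length h4
    simp at this
    exact Fin.ext this
  subst hi
  have hm : m = m₁ := by
    funext j
    have := congrFun (List.ofFn_injective h4) j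
    exact Option.map_injective Fin.val_injective this
  rwa [hm]

theorem Describes.exists_of_mem_table {n k : ℕ} {c : NDCMACode} {A : NDCMA (Fin n) (Fin k) l}
    (h : c.Describes A) {q : Fin n} {a : ℕ} {i : ℕ} {m : Fin (i + 1) → Option (Fin n)} {q' : ℕ}
    (ht : (q.val, a, List.ofFn (fun j => (m j).map Fin.val), q') ∈ c.table) :
    ∃ (hi : i < l) (b : Fin k) (r : Fin n), a = b.val ∧ q' = r.val ∧
      r ∈ A.δ ⟨i, hi⟩ q b m := by
  obtain ⟨i₁, q₁, a₁, m₁, q₁', h1, h2⟩ := (h.2.2.2.1 _).1 ht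
  simp only [Prod.mk.injEq] at h2
  obtain ⟨h2, rfl, h4, rfl⟩ := h2
  have hi : i = i₁ := by
    have := congrArg List.length h4
    simpa using this
  subst hi
  exact ⟨i₁.2, a₁, q₁', rfl, rfl, h.mem_table.1 ht⟩

/-- Needed for equivalence, where the two containments come with automata that are a priori
different. -/
theorem Describes.unique {n k : ℕ} {c : NDCMACode} {A B : NDCMA (Fin n) (Fin k) l}
    (hA : c.Describes A) (hB : c.Describes B) : A = B := by
  have hinit : A.init = B.init := Fin.ext (hA.2.2.1.symm.trans hB.2.2.1)
  have hδ : A.δ = B.δ := by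
    funext i q a m
    ext q'
    rw [← hA.mem_table, hB.mem_table]
  have hFL : A.FL = B.FL := by
    ext q
    have := (hA.2.2.2.2.1 q.val).symm.trans (hB.2.2.2.2.1 q.val)
    simpa [Fin.val_inj] using this
  have hFG : A.FG = B.FG := by
    ext q
    have := (hA.2.2.2.2.2 q.val).symm.trans (hB.2.2.2.2.2 q.val)
    simpa [Fin.val_inj] using this
  cases A
  cases B
  simp_all

theorem Describes.mem_globals {n k : ℕ} {c : NDCMACode} {A : NDCMA (Fin n) (Fin k) l}
    (h : c.Describes A) {q : Fin n} : q.val ∈ c.globals ↔ q ∈ A.FG := by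
  rw [h.2.2.2.2.2 q.val]
  simp [Fin.val_inj]

theorem exists_ofFn_of_mem_tuplesUpTo {n : ℕ} {m : List (Option ℕ)}
    (hm : m ∈ tuplesUpTo (List.range n) l) (hm0 : m ≠ []) :
    ∃ (i : Fin l) (m' : Fin (i + 1) → Option (Fin n)),
      m = List.ofFn fun j => (m' j).map Fin.val := by
  obtain ⟨h1, h2⟩ := mem_tuplesUpTo.1 hm
  obtain ⟨i, y, rfl⟩ := exists_eq_ofFn hm0
  rw [List.length_ofFn] at h1
  refine ⟨⟨i, h1⟩, fun j => (y j).pmap (fun a ha => (⟨a, ha⟩ : Fin n))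
    fun a ha => ?_, ?_⟩
  · refine List.mem_range.1 (h2 a ?_)
    rw [List.mem_ofFn]
    exact ⟨j, ha⟩
  · congr 1
    funext j
    rw [Option.map_pmap]
    simp

theorem ofFn_mem_tuplesUpTo {n : ℕ} (i : Fin l) (m : Fin (i + 1) → Option (Fin n)) :
    (List.ofFn fun j => (m j).map Fin.val) ∈ tuplesUpTo (List.range n) l := by
  refine mem_tuplesUpTo.2 ⟨by simp, fun a ha => ?_⟩
  obtain ⟨j, hj⟩ := (List.mem_ofFn' _ _).1 ha
  obtain ⟨b, -, rfl⟩ := Option.map_eq_some_iff.1 hj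
  simp

theorem Describes.valid {n k : ℕ} {c : NDCMACode} {A : NDCMA (Fin n) (Fin k) l}
    (h : c.Describes A) (hd : A.Deterministic) (hw : A.Weak) : Valid l c := by
  have hk : c.letters = k := h.1
  have hn : c.states = n := h.2.1
  refine ⟨?_, fun t ht => ?_, ?_, fun s hs => ?_, fun s hs => ?_, fun s hs => ?_⟩
  · rw [hn, show c.start = _ from h.2.2.1]
    exact A.init.2
  · obtain ⟨i, q, a, m, q', -, rfl⟩ := (h.2.2.2.1 t).1 ht
    rw [hn, hk]
    exact ⟨q.2, a.2, by simp, ofFn_mem_tuplesUpTo i m, q'.2⟩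
  · rw [hn, hk]
    intro q hq a ha m hm hm0
    obtain ⟨i, m, rfl⟩ := exists_ofFn_of_mem_tuplesUpTo hm hm0
    obtain ⟨q', hq'⟩ := hd i ⟨q, hq⟩ ⟨a, ha⟩ m
    refine ⟨q', q'.2, fun r hr => ?_⟩
    have := h.mem_table (i := i) (q := ⟨q, hq⟩) (a := ⟨a, ha⟩) (m := m) (q' := ⟨r, hr⟩)
    rw [this, hq', Set.mem_singleton_iff, Fin.ext_iff]
  · obtain ⟨q, -, rfl⟩ := (h.2.2.2.2.1 s).1 hs
    exact hn ▸ q.2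
  · exact (h.2.2.2.2.1 s).2 ⟨⟨s, hn ▸ hs⟩, hw ▸ Set.mem_univ _, rfl⟩
  · obtain ⟨q, -, rfl⟩ := (h.2.2.2.2.2 s).1 hs
    exact hn ▸ q.2

theorem Valid.exists_describes {c : NDCMACode} (h : Valid l c) :
    ∃ A : NDCMA (Fin c.states) (Fin c.letters) l, c.Describes A ∧ A.Deterministic ∧ A.Weak := by
  obtain ⟨h1, h2, h3, h4, h5, h6⟩ := h
  let A : NDCMA (Fin c.states) (Fin c.letters) l :=
    { init := ⟨c.start, h1⟩
      δ := fun i q a m =>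
        {q' | (q.val, a.val, List.ofFn (fun j => (m j).map Fin.val), q'.val) ∈ c.table}
      FL := Set.univ
      FG := {q | q.val ∈ c.globals}
      FG_subset_FL := Set.subset_univ _ }
  refine ⟨A, ⟨rfl, rfl, rfl, fun t => ⟨fun ht => ?_, ?_⟩, fun s => ⟨fun hs => ?_, ?_⟩,
    fun s => ⟨fun hs => ⟨⟨s, h6 s hs⟩, hs, rfl⟩, ?_⟩⟩, fun i q a m => ?_, rfl⟩
  · obtain ⟨q, a, m, q'⟩ := t
    obtain ⟨hq, ha, hm0, hm, hq'⟩ := h2 _ ht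
    obtain ⟨i, m', hm'⟩ := exists_ofFn_of_mem_tuplesUpTo hm hm0
    dsimp only at hm'
    subst hm'
    exact ⟨i, ⟨q, hq⟩, ⟨a, ha⟩, m', ⟨q', hq'⟩, ht, rfl⟩
  · rintro ⟨i, q, a, m, q', hq', rfl⟩
    exact hq'
  · exact ⟨⟨s, h4 s hs⟩, Set.mem_univ _, rfl⟩
  · rintro ⟨q, -, rfl⟩
    exact h5 q q.2
  · rintro ⟨q, hq, rfl⟩
    exact hq
  · obtain ⟨q', hq', h⟩ := h3 q q.2 a a.2 _ (ofFn_mem_tuplesUpTo i m) (by simp)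
    refine ⟨⟨q', hq'⟩, ?_⟩
    ext r
    exact (h r r.2).trans (Fin.ext_iff (b := ⟨q', hq'⟩)).symm

section Containment

variable {k n₁ n₂ : ℕ} {c₁ c₂ : NDCMACode} {A : NDCMA (Fin n₁) (Fin k) l}
  {B : NDCMA (Fin n₂) (Fin k) l}

/-- Since `B` always has a next state, it can follow any run of `A` on the same word. -/
theorem exists_product_run (h₁ : c₁.Describes A) (h₂ : c₂.Describes B) (hB : B.Deterministic)
    {N : NestedDataset D l} {a a' : NDCMAConfig (Fin n₁) D} {w : List (Fin k × D)}
    (hw : A.Run N a w a') (b : NDCMAConfig (Fin n₂) D)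
    (s : (ℕ × ℕ) × (List D → Option (ℕ × ℕ))) (ha : Tracks N Prod.fst s a)
    (hb : Tracks N Prod.snd s b) :
    ∃ b' s', B.Run N b w b' ∧
      Relation.ReflTransGen (TreeStep (branches N.pred) (Rule c₁ c₂)) s s' ∧
      Tracks N Prod.fst s' a' ∧ Tracks N Prod.snd s' b' := by
  induction hw generalizing b s with
  | nil a => exact ⟨b, s, .nil b, .refl, ha, hb⟩
  | @cons a a₁ a₂ p w hstep _ ih =>
    obtain ⟨e, d⟩ := p
    obtain ⟨i, x, hx, hxd, hq, hm, ho⟩ := hstep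
    dsimp only at hxd hq
    subst hxd
    have hx' := isBranch_iff.1 hx
    obtain ⟨r, hr⟩ := hB i b.state e fun j => b.mem (x j)
    obtain ⟨b₁, rfl, hm', ho', hstep'⟩ :=
      NDCMA.exists_step (A := B) hx (hr ▸ Set.mem_singleton r)
    obtain ⟨b', s', h3, h4, h5⟩ := ih b₁
      ((a₁.state.val, b₁.state.val), writePath s.2 (a₁.state.val, b₁.state.val) (List.ofFn x))
      (ha.write hx' rfl hm ho) (hb.write hx' rfl hm' ho')
    refine ⟨b', s', .cons hstep' h3, .head ⟨List.ofFn x, hx', ⟨e, ?_, ?_, ?_⟩, rfl⟩ h4, h5⟩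
    · rw [show c₁.letters = k from h₁.1]
      exact e.2
    · rw [ha.map_trace hx', ha.1]
      exact h₁.mem_table.2 hq
    · rw [hb.map_trace hx', hb.1]
      exact h₂.mem_table.2 (hr ▸ Set.mem_singleton _)

theorem exists_runs (h₁ : c₁.Describes A) (h₂ : c₂.Describes B) {N : NestedDataset D l}
    {s s' : (ℕ × ℕ) × (List D → Option (ℕ × ℕ))}
    (h : Relation.ReflTransGen (TreeStep (branches N.pred) (Rule c₁ c₂)) s s')
    (a : NDCMAConfig (Fin n₁) D) (b : NDCMAConfig (Fin n₂) D) (ha : Tracks N Prod.fst s a)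
    (hb : Tracks N Prod.snd s b) :
    ∃ w a' b', A.Run N a w a' ∧ B.Run N b w b' ∧ Tracks N Prod.fst s' a' ∧
      Tracks N Prod.snd s' b' := by
  induction h using Relation.ReflTransGen.head_induction_on generalizing a b with
  | refl => exact ⟨[], a, b, .nil a, .nil b, ha, hb⟩
  | @head s s₁ hstep _ ih =>
    obtain ⟨z, hz, ⟨e, he, hA, hB⟩, hs₁⟩ := hstep
    obtain ⟨q, g⟩ := s₁
    dsimp only at hs₁ hA hB
    -- The empty list counts as a branch only to serve as the root of the full tree; no transition
    -- reads an empty tuple.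
    have hz0 : z ≠ [] := by
      rintro rfl
      obtain ⟨i, _, _, m, _, -, h⟩ := (h₁.2.2.2.1 _).1 hA
      have := congrArg (fun t => t.2.2.1.length) h
      simp [trace] at this
    obtain ⟨i, x, rfl⟩ := exists_eq_ofFn hz0
    rw [ha.map_trace hz, ha.1] at hA
    rw [hb.map_trace hz, hb.1] at hB
    obtain ⟨hi, e₁, r₁, rfl, hr₁, hA⟩ := h₁.exists_of_mem_table hA
    obtain ⟨_, e₂, r₂, he₂, hr₂, hB⟩ := h₂.exists_of_mem_table hB
    obtain rfl := Fin.ext he₂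
    have hx := isBranch_iff.2 hz
    obtain ⟨a₁, rfl, hma, hoa, hsa⟩ := NDCMA.exists_step (i := ⟨_, hi⟩) hx hA
    obtain ⟨b₁, rfl, hmb, hob, hsb⟩ := NDCMA.exists_step (i := ⟨_, hi⟩) hx hB
    subst hs₁
    obtain ⟨w, a', b', h3, h4, h5⟩ := ih a₁ b₁ (ha.write hz hr₁ hma hoa)
      (hb.write hz hr₂ hmb hob)
    exact ⟨_, a', b', .cons hsa h3, .cons hsb h4, h5⟩

/-- Weakness reduces acceptance to the control state. A bad run of the product splits into an
accepting run of `A` and a rejecting run of `B` on one word, and the latter is the only run of `B`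
on it. -/
theorem language_subset_iff (h₁ : c₁.Describes A) (h₂ : c₂.Describes B) (hA : A.Weak)
    (hB : B.Deterministic) (hB' : B.Weak) (N : NestedDataset D l) :
    A.language N ⊆ B.language N ↔ ¬ BadRun (branches N.pred) c₁ c₂ := by
  have hfin : ∀ {n : ℕ} {C : NDCMA (Fin n) (Fin k) l}, C.Weak → ∀ c : NDCMAConfig (Fin n) D,
      C.IsFinal c ↔ c.state ∈ C.FG := fun hC c =>
    ⟨fun h => h.1, fun h => ⟨h, fun d q _ => hC ▸ Set.mem_univ q⟩⟩
  have ha := tracks_init N Prod.fst A (q := (c₁.start, c₂.start)) h₁.2.2.1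
  have hb := tracks_init N Prod.snd B (q := (c₁.start, c₂.start)) h₂.2.2.1
  constructor
  · rintro h ⟨s, hs, hs1, hs2⟩
    obtain ⟨w, a', b', h3, h4, h5, h6⟩ := exists_runs h₁ h₂ hs _ _ ha hb
    rw [h5.1, h₁.mem_globals] at hs1
    rw [h6.1, h₂.mem_globals] at hs2
    obtain ⟨b₂, h7, h8⟩ := h ⟨a', h3, (hfin hA _).2 hs1⟩
    obtain rfl := hB.run_unique h4 h7
    exact hs2 h8.1
  · rintro h w ⟨a', h3, h4⟩
    obtain ⟨b', s', h5, h6, h7, h8⟩ := exists_product_run h₁ h₂ hB h3 _ _ ha hb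
    refine ⟨b', h5, (hfin hB' _).2 ?_⟩
    by_contra hcon
    refine h ⟨s', h6, ?_, ?_⟩
    · rw [h7.1, h₁.mem_globals]
      exact h4.1
    · rwa [h8.1, h₂.mem_globals]

end Containment

/-- The containment problem in terms of the backward search. -/
def Contained (x : ℕ × NDCMACode × NDCMACode) : Prop :=
  (x.2.1.letters = x.2.2.letters ∧ Valid x.1 x.2.1 ∧ Valid x.1 x.2.2) ∧
    ¬ Refuted x.1 x.2.1 x.2.2

theorem contained_iff (N : NestedDataset D l) (c₁ c₂ : NDCMACode) :
    Contained (l, c₁, c₂) ↔ ContainmentInstance N c₁ c₂ := by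
  constructor
  · rintro ⟨⟨hk, h₁, h₂⟩, h⟩
    obtain ⟨A, hA, hA1, hA2⟩ := h₁.exists_describes
    obtain ⟨B, hB, hB1, hB2⟩ := h₂.exists_describes
    dsimp only at hk h
    rw [← badRun_iff_refuted N.isFullTree h₁ h₂] at h
    obtain ⟨k, n, r⟩ := c₁
    obtain ⟨k', n', r'⟩ := c₂
    dsimp only [letters, states] at hk A B
    subst hk
    exact ⟨k, n, n', A, B, hA, hB, hA1, hA2, hB1, hB2,
      (language_subset_iff hA hB hA2 hB1 hB2 N).2 h⟩
  · rintro ⟨k, n₁, n₂, A, B, hA, hB, hA1, hA2, hB1, hB2, h⟩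
    have h₁ := hA.valid hA1 hA2
    have h₂ := hB.valid hB1 hB2
    refine ⟨⟨hA.1.trans hB.1.symm, h₁, h₂⟩, ?_⟩
    rw [← badRun_iff_refuted N.isFullTree h₁ h₂]
    exact (language_subset_iff hA hB hA2 hB1 hB2 N).1 h

theorem equivalenceInstance_iff (N : NestedDataset D l) (c₁ c₂ : NDCMACode) :
    EquivalenceInstance N c₁ c₂ ↔ ContainmentInstance N c₁ c₂ ∧ ContainmentInstance N c₂ c₁ := by
  constructor
  · rintro ⟨k, n₁, n₂, A, B, hA, hB, hA1, hA2, hB1, hB2, h⟩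
    exact ⟨⟨k, n₁, n₂, A, B, hA, hB, hA1, hA2, hB1, hB2, h.subset⟩,
      ⟨k, n₂, n₁, B, A, hB, hA, hB1, hB2, hA1, hA2, h.symm.subset⟩⟩
  · rintro ⟨⟨k, n₁, n₂, A, B, hA, hB, hA1, hA2, hB1, hB2, h⟩,
      ⟨k', n₂', n₁', B', A', hB', hA', -, -, -, -, h'⟩⟩
    -- The codes fix the alphabet, the numbers of states and then the automata, so both containments
    -- speak of the same pair.
    obtain rfl : k = k' := hA.1.symm.trans hA'.1
    obtain rfl : n₁ = n₁' := hA.2.1.symm.trans hA'.2.1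
    obtain rfl : n₂ = n₂' := hB.2.1.symm.trans hB'.2.1
    obtain rfl := hA.unique hA'
    obtain rfl := hB.unique hB'
    exact ⟨k, n₁, n₂, A, B, hA, hB, hA1, hA2, hB1, hB2, h.antisymm h'⟩

end NDCMACode

end Automata

/-! ### Primitive recursiveness of search and certificates, and decidability. -/

section Effectivity

variable {γ β σ : Type} [Primcodable γ] [Primcodable β] [Primcodable σ]

theorem PrimrecPred.exists_mem {f : γ → List β} {p : γ → β → Prop} (hf : Primrec f)
    (hp : PrimrecPred fun z : γ × β => p z.1 z.2) : PrimrecPred fun x => ∃ b ∈ f x, p x b :=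
  (PrimrecRel.exists_mem_list (R := fun b x => p x b)
    (hp.comp (Primrec.snd.pair Primrec.fst))).comp hf Primrec.id

theorem PrimrecPred.forall_mem {f : γ → List β} {p : γ → β → Prop} (hf : Primrec f)
    (hp : PrimrecPred fun z : γ × β => p z.1 z.2) : PrimrecPred fun x => ∀ b ∈ f x, p x b :=
  (PrimrecRel.forall_mem_list (R := fun b x => p x b)
    (hp.comp (Primrec.snd.pair Primrec.fst))).comp hf Primrec.id

theorem PrimrecPred.exists_lt_of {f : γ → ℕ} {p : γ → ℕ → Prop} (hf : Primrec f)
    (hp : PrimrecPred fun z : γ × ℕ => p z.1 z.2) : PrimrecPred fun x => ∃ k < f x, p x k :=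
  (PrimrecPred.exists_mem (Primrec.list_range.comp hf) hp).of_eq fun x => by simp

theorem PrimrecPred.forall_lt_of {f : γ → ℕ} {p : γ → ℕ → Prop} (hf : Primrec f)
    (hp : PrimrecPred fun z : γ × ℕ => p z.1 z.2) : PrimrecPred fun x => ∀ k < f x, p x k :=
  (PrimrecPred.forall_mem (Primrec.list_range.comp hf) hp).of_eq fun x => by simp

theorem PrimrecPred.imp {p q : γ → Prop} (hp : PrimrecPred p) (hq : PrimrecPred q) :
    PrimrecPred fun x => p x → q x :=
  (hp.not.or hq).of_eq fun x => by tauto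

theorem PrimrecPred.iff {p q : γ → Prop} (hp : PrimrecPred p) (hq : PrimrecPred q) :
    PrimrecPred fun x => (p x ↔ q x) :=
  ((hp.imp hq).and (hq.imp hp)).of_eq fun x => by tauto

theorem Primrec.mem_list {f : γ → β} {g : γ → List β} (hf : Primrec f) (hg : Primrec g) :
    PrimrecPred fun x => f x ∈ g x :=
  (PrimrecPred.exists_mem (p := fun x b => b = f x) hg (Primrec.eq.comp Primrec.snd (hf.comp Primrec.fst))).of_eq
    fun x => by simp

theorem Primrec.list_prefix {f g : γ → List β} (hf : Primrec f) (hg : Primrec g) :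
    PrimrecPred fun x => f x <+: g x :=
  (Primrec.eq.comp hf (Primrec.list_take.comp (Primrec.list_length.comp hf) hg)).of_eq
    fun _ => List.prefix_iff_eq_take.symm

theorem Primrec.list_filter_of {f : γ → List β} {p : γ → β → Prop}
    [∀ x, DecidablePred (p x)] (hf : Primrec f) (hp : PrimrecPred fun z : γ × β => p z.1 z.2) :
    Primrec fun x => (f x).filter fun b => p x b := by
  have h : Primrec fun x => (f x).filterMap fun b => if p x b then some b else none :=
    Primrec.listFilterMap hf (Primrec.ite hp (Primrec.option_some.comp Primrec.snd)
      (Primrec.const none))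
  refine h.of_eq fun x => ?_
  rw [← List.filterMap_eq_filter]
  congr 1
  funext b
  simp [Option.guard]

theorem Primrec.wordsOfLength {f : γ → List β} {g : γ → ℕ} (hf : Primrec f) (hg : Primrec g) :
    Primrec fun x => wordsOfLength (f x) (g x) := by
  refine Primrec.nat_rec' hg (Primrec.const [[]]) (h := fun x z => z.2.flatMap fun w =>
    (f x).map fun a => a :: w) ?_
  refine Primrec.list_flatMap (Primrec.snd.comp Primrec.snd) ?_
  exact Primrec.list_map (hf.comp (Primrec.fst.comp Primrec.fst))
    (Primrec.list_cons.comp Primrec.snd (Primrec.snd.comp Primrec.fst))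

theorem Primrec.tuplesUpTo {f : γ → List β} {g : γ → ℕ} (hf : Primrec f) (hg : Primrec g) :
    Primrec fun x => tuplesUpTo (f x) (g x) := by
  refine Primrec.list_flatMap (Primrec.list_range.comp (Primrec.succ.comp hg)) ?_
  refine Primrec.wordsOfLength (Primrec.list_cons.comp (Primrec.const none) ?_) Primrec.snd
  exact Primrec.list_map (hf.comp Primrec.fst) (Primrec.option_some.comp Primrec.snd)

theorem Primrec.marks {f : γ → List (Option β)} {g : γ → List ℕ} (hf : Primrec f)
    (hg : Primrec g) : Primrec fun x => marks (f x) (g x) := by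
  refine Primrec.listFilterMap (Primrec.list_range.comp (Primrec.list_length.comp hf)) ?_
  refine Primrec.option_map (f := fun z : γ × ℕ => ((f z.1)[z.2]?).join)
    (g := fun z a => ((g z.1).take (z.2 + 1), a)) ?_ ?_
  · exact Primrec.option_bind (Primrec.list_getElem?.comp (hf.comp Primrec.fst) Primrec.snd)
      Primrec.snd
  · refine Primrec.pair (Primrec.list_take.comp ?_ ?_) Primrec.snd
    · exact Primrec.succ.comp (Primrec.snd.comp Primrec.fst)
    · exact hg.comp (Primrec.fst.comp Primrec.fst)

theorem Primrec.unwrite {f : γ → List (Option β)} {g : γ → List ℕ}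
    {h : γ → List (List ℕ × β)} (hf : Primrec f) (hg : Primrec g) (hh : Primrec h) :
    Primrec fun x => unwrite (f x) (g x) (h x) :=
  Primrec.list_append.comp (Primrec.list_filter_of hh (Primrec.list_prefix
    (Primrec.fst.comp Primrec.snd) (hg.comp Primrec.fst)).not) (Primrec.marks hf hg)

theorem Primrec.extendPath {f : γ → List ℕ} {g h : γ → ℕ} (hf : Primrec f) (hg : Primrec g)
    (hh : Primrec h) : Primrec fun x => extendPath (f x) (g x) (h x) := by
  refine Primrec.list_map (Primrec.list_range.comp hg) ?_
  exact Primrec.option_getD.comp (Primrec.list_getElem?.comp (hf.comp Primrec.fst) Primrec.snd)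
    (hh.comp Primrec.fst)

theorem Primrec.freshIndex {f : γ → List (List ℕ × β)} (hf : Primrec f) :
    Primrec fun x => freshIndex (f x) := by
  refine Primrec.succ.comp (f := Nat.succ) ?_
  refine (Primrec.list_foldr (f := fun x => (f x).flatMap Prod.fst)
    (h := fun _ z => z.1 + z.2) ?_ (Primrec.const 0) ?_).of_eq fun x => List.sum_eq_foldr.symm
  · exact Primrec.list_flatMap hf (Primrec.fst.comp Primrec.snd)
  · exact Primrec.nat_add.comp (Primrec.fst.comp Primrec.snd) (Primrec.snd.comp Primrec.snd)

theorem Primrec.isForest {f : γ → ℕ} {Λ : γ → β → Prop} {g : γ → List (List ℕ × β)}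
    (hf : Primrec f) (hΛ : PrimrecPred fun z : γ × β => Λ z.1 z.2) (hg : Primrec g) :
    PrimrecPred fun x => IsForest (f x) (Λ x) (g x) := by
  have h1 : PrimrecPred fun x => ∀ e ∈ g x, e.1 ≠ [] :=
    .forall_mem hg (Primrec.eq.comp (Primrec.fst.comp Primrec.snd) (Primrec.const [])).not
  have h2 : PrimrecPred fun x => ∀ e ∈ g x, e.1.length ≤ f x :=
    .forall_mem hg (Primrec.nat_le.comp (Primrec.list_length.comp (Primrec.fst.comp Primrec.snd))
      (hf.comp Primrec.fst))
  have h3 : PrimrecPred fun x => ∀ e ∈ g x, Λ x e.2 :=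
    .forall_mem hg (hΛ.comp (Primrec.fst.pair (Primrec.snd.comp Primrec.snd)))
  have h4 : PrimrecPred fun x => ∀ e ∈ g x, ∀ j < e.1.length, j ≠ 0 →
      ∃ e' ∈ g x, e'.1 = e.1.take j := by
    refine .forall_mem hg (.forall_lt_of (p := fun (z : γ × (List ℕ × β)) j => j ≠ 0 →
      ∃ e' ∈ g z.1, e'.1 = z.2.1.take j)
      (Primrec.list_length.comp (Primrec.fst.comp Primrec.snd)) (.imp
      (Primrec.eq.comp Primrec.snd (Primrec.const 0)).not (.exists_mem
      (f := fun z : (γ × (List ℕ × β)) × ℕ => g z.1.1)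
      (p := fun z e' => e'.1 = z.1.2.1.take z.2)
      (hg.comp (Primrec.fst.comp Primrec.fst)) (Primrec.eq.comp (Primrec.fst.comp Primrec.snd)
      (Primrec.list_take.comp (Primrec.snd.comp Primrec.fst) ?_)))))
    exact Primrec.fst.comp (Primrec.snd.comp (Primrec.fst.comp Primrec.fst))
  have h5 : PrimrecPred fun x => ∀ e ∈ g x, ∀ e' ∈ g x, e.1 = e'.1 → e.2 = e'.2 := by
    refine .forall_mem hg (.forall_mem
      (p := fun (z : γ × (List ℕ × β)) e' => z.2.1 = e'.1 → z.2.2 = e'.2) (hg.comp Primrec.fst) (.imp ?_ ?_))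
    · exact Primrec.eq.comp (Primrec.fst.comp (Primrec.snd.comp Primrec.fst))
        (Primrec.fst.comp Primrec.snd)
    · exact Primrec.eq.comp (Primrec.snd.comp (Primrec.snd.comp Primrec.fst))
        (Primrec.snd.comp Primrec.snd)
  exact (h1.and (h2.and (h3.and (h4.and h5)))).of_eq fun x =>
    ⟨fun ⟨a, b, c, d, e⟩ => ⟨a, b, c, d, e⟩, fun ⟨a, b, c, d, e⟩ => ⟨a, b, c, d, e⟩⟩

namespace NDCMACode

variable {c c₁ c₂ : γ → NDCMACode} {l : γ → ℕ}

theorem primrec_letters (hc : Primrec c) : Primrec fun x => (c x).letters := Primrec.fst.comp hc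

theorem primrec_states (hc : Primrec c) : Primrec fun x => (c x).states :=
  Primrec.fst.comp (Primrec.snd.comp hc)

theorem primrec_start (hc : Primrec c) : Primrec fun x => (c x).start :=
  Primrec.fst.comp (Primrec.snd.comp (Primrec.snd.comp hc))

theorem primrec_table (hc : Primrec c) : Primrec fun x => (c x).table :=
  Primrec.fst.comp (Primrec.snd.comp (Primrec.snd.comp (Primrec.snd.comp hc)))

theorem primrec_locals (hc : Primrec c) : Primrec fun x => (c x).locals :=
  Primrec.fst.comp (Primrec.snd.comp (Primrec.snd.comp (Primrec.snd.comp (Primrec.snd.comp hc))))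

theorem primrec_globals (hc : Primrec c) : Primrec fun x => (c x).globals :=
  Primrec.snd.comp (Primrec.snd.comp (Primrec.snd.comp (Primrec.snd.comp (Primrec.snd.comp hc))))

theorem primrec_label {q : γ → ℕ × ℕ} (h₁ : Primrec c₁) (h₂ : Primrec c₂) (hq : Primrec q) :
    PrimrecPred fun x => Label (c₁ x) (c₂ x) (q x) :=
  (Primrec.nat_lt.comp (Primrec.fst.comp hq) (primrec_states h₁)).and
    (Primrec.nat_lt.comp (Primrec.snd.comp hq) (primrec_states h₂))

theorem primrec_labels (h₁ : Primrec c₁) (h₂ : Primrec c₂) :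
    Primrec fun x => labels (c₁ x) (c₂ x) := by
  refine Primrec.list_flatMap (Primrec.list_range.comp (primrec_states h₁)) ?_
  refine Primrec.list_map (Primrec.list_range.comp (primrec_states (h₂.comp Primrec.fst))) ?_
  exact Primrec.pair (Primrec.snd.comp Primrec.fst) Primrec.snd

theorem primrec_rule {q q' : γ → ℕ × ℕ} {m : γ → List (Option (ℕ × ℕ))} (h₁ : Primrec c₁)
    (h₂ : Primrec c₂) (hq : Primrec q) (hm : Primrec m) (hq' : Primrec q') :
    PrimrecPred fun x => Rule (c₁ x) (c₂ x) (q x) (m x) (q' x) := by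
  have hmap : ∀ {π : ℕ × ℕ → ℕ}, Primrec π →
      Primrec fun x => (m x).map (Option.map π) := fun hπ =>
    Primrec.list_map hm ((Primrec.option_map₁ hπ).comp Primrec.snd)
  refine .exists_lt_of (primrec_letters h₁) (.and ?_ ?_)
  · exact Primrec.mem_list (((Primrec.fst.comp hq).comp Primrec.fst).pair (Primrec.snd.pair
      (((hmap Primrec.fst).comp Primrec.fst).pair ((Primrec.fst.comp hq').comp Primrec.fst))))
      (primrec_table (h₁.comp Primrec.fst))
  · exact Primrec.mem_list (((Primrec.snd.comp hq).comp Primrec.fst).pair (Primrec.snd.pair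
      (((hmap Primrec.snd).comp Primrec.fst).pair ((Primrec.snd.comp hq').comp Primrec.fst))))
      (primrec_table (h₂.comp Primrec.fst))

theorem primrec_valid (hl : Primrec l) (hc : Primrec c) :
    PrimrecPred fun x => Valid (l x) (c x) := by
  have htup : Primrec fun x => tuplesUpTo (List.range (c x).states) (l x) :=
    Primrec.tuplesUpTo (Primrec.list_range.comp (primrec_states hc)) hl
  have h1 : PrimrecPred fun x => (c x).start < (c x).states :=
    Primrec.nat_lt.comp (primrec_start hc) (primrec_states hc)
  have h2 : PrimrecPred fun x => ∀ t ∈ (c x).table,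
      t.1 < (c x).states ∧ t.2.1 < (c x).letters ∧ t.2.2.1 ≠ [] ∧
      t.2.2.1 ∈ tuplesUpTo (List.range (c x).states) (l x) ∧ t.2.2.2 < (c x).states := by
    have hn := (primrec_states hc).comp (Primrec.fst (β := ℕ × ℕ × List (Option ℕ) × ℕ))
    have hm : Primrec fun z : γ × (ℕ × ℕ × List (Option ℕ) × ℕ) => z.2.2.2.1 :=
      Primrec.fst.comp (Primrec.snd.comp (Primrec.snd.comp Primrec.snd))
    refine .forall_mem (primrec_table hc) (.and ?_ (.and ?_ (.and ?_ (.and ?_ ?_))))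
    · exact Primrec.nat_lt.comp (Primrec.fst.comp Primrec.snd) hn
    · exact Primrec.nat_lt.comp (Primrec.fst.comp (Primrec.snd.comp Primrec.snd))
        ((primrec_letters hc).comp Primrec.fst)
    · exact (Primrec.eq.comp hm (Primrec.const [])).not
    · exact Primrec.mem_list hm (htup.comp Primrec.fst)
    · exact Primrec.nat_lt.comp
        (Primrec.snd.comp (Primrec.snd.comp (Primrec.snd.comp Primrec.snd))) hn
  have h3 : PrimrecPred fun x => ∀ q < (c x).states, ∀ a < (c x).letters,
      ∀ m ∈ tuplesUpTo (List.range (c x).states) (l x), m ≠ [] →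
      ∃ q' < (c x).states, ∀ r < (c x).states, ((q, a, m, r) ∈ (c x).table ↔ r = q') := by
    have hn := primrec_states hc
    refine .forall_lt_of hn (.forall_lt_of (f := fun z : γ × ℕ => (c z.1).letters)
      (p := fun (z : γ × ℕ) a => ∀ m ∈ tuplesUpTo (List.range (c z.1).states) (l z.1), m ≠ [] →
      ∃ q' < (c z.1).states, ∀ r < (c z.1).states, ((z.2, a, m, r) ∈ (c z.1).table ↔ r = q'))
      ((primrec_letters hc).comp Primrec.fst) (.forall_mem
      (f := fun z : (γ × ℕ) × ℕ => tuplesUpTo (List.range (c z.1.1).states) (l z.1.1))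
      (p := fun z m => m ≠ [] → ∃ q' < (c z.1.1).states, ∀ r < (c z.1.1).states,
        ((z.1.2, z.2, m, r) ∈ (c z.1.1).table ↔ r = q'))
      (htup.comp (Primrec.fst.comp Primrec.fst)) (.imp
      (Primrec.eq.comp Primrec.snd (Primrec.const [])).not (.exists_lt_of
      (f := fun z : ((γ × ℕ) × ℕ) × List (Option ℕ) => (c z.1.1.1).states)
      (p := fun z q' => ∀ r < (c z.1.1.1).states,
        ((z.1.1.2, z.1.2, z.2, r) ∈ (c z.1.1.1).table ↔ r = q'))
      (hn.comp (Primrec.fst.comp (Primrec.fst.comp Primrec.fst))) (.forall_lt_of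
      (f := fun z : (((γ × ℕ) × ℕ) × List (Option ℕ)) × ℕ => (c z.1.1.1.1).states)
      (p := fun z r => (z.1.1.1.2, z.1.1.2, z.1.2, r) ∈ (c z.1.1.1.1).table ↔ r = z.2)
      (hn.comp (Primrec.fst.comp (Primrec.fst.comp (Primrec.fst.comp Primrec.fst)))) (.iff
      (Primrec.mem_list (Primrec.pair ?_ (Primrec.pair ?_ (Primrec.pair ?_ Primrec.snd)))
        ((primrec_table hc).comp ?_))
      (Primrec.eq.comp Primrec.snd (Primrec.snd.comp Primrec.fst))))))))
    · exact Primrec.snd.comp (Primrec.fst.comp (Primrec.fst.comp (Primrec.fst.comp Primrec.fst)))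
    · exact Primrec.snd.comp (Primrec.fst.comp (Primrec.fst.comp Primrec.fst))
    · exact Primrec.snd.comp (Primrec.fst.comp Primrec.fst)
    · exact Primrec.fst.comp (Primrec.fst.comp (Primrec.fst.comp
        (Primrec.fst.comp Primrec.fst)))
  have h4 : PrimrecPred fun x => ∀ s ∈ (c x).locals, s < (c x).states :=
    .forall_mem (primrec_locals hc)
      (Primrec.nat_lt.comp Primrec.snd ((primrec_states hc).comp Primrec.fst))
  have h5 : PrimrecPred fun x => ∀ s < (c x).states, s ∈ (c x).locals :=
    .forall_lt_of (primrec_states hc)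
      (Primrec.mem_list Primrec.snd ((primrec_locals hc).comp Primrec.fst))
  have h6 : PrimrecPred fun x => ∀ s ∈ (c x).globals, s < (c x).states :=
    .forall_mem (primrec_globals hc)
      (Primrec.nat_lt.comp Primrec.snd ((primrec_states hc).comp Primrec.fst))
  exact h1.and (h2.and (h3.and (h4.and (h5.and h6))))

theorem primrec_predVia {q q' : γ → ℕ × ℕ} {m : γ → List (Option (ℕ × ℕ))} {y : γ → List ℕ}
    {L : γ → List (List ℕ × (ℕ × ℕ))} (hl : Primrec l) (h₁ : Primrec c₁) (h₂ : Primrec c₂)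
    (hq : Primrec q) (hq' : Primrec q') (hm : Primrec m) (hy : Primrec y) (hL : Primrec L) :
    PrimrecPred fun x => PredVia (l x) (c₁ x) (c₂ x) (q x) (q' x) (m x) (y x) (L x) := by
  refine (primrec_rule h₁ h₂ hq hm hq').and (.and (.forall_mem hL (.imp ?_ ?_)) ?_)
  · exact Primrec.list_prefix (Primrec.fst.comp Primrec.snd) (hy.comp Primrec.fst)
  · exact Primrec.eq.comp (Primrec.snd.comp Primrec.snd) (hq'.comp Primrec.fst)
  · exact Primrec.isForest hl (primrec_label (h₁.comp Primrec.fst) (h₂.comp Primrec.fst)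
      Primrec.snd) (Primrec.unwrite hm hy hL)

theorem primrec_preds {u : γ → SymbolicConfig} (hl : Primrec l) (h₁ : Primrec c₁)
    (h₂ : Primrec c₂) (hu : Primrec u) :
    Primrec fun x => preds (l x) (c₁ x) (c₂ x) (u x) := by
  classical
  refine Primrec.list_flatMap (primrec_labels h₁ h₂) (Primrec.list_flatMap
    (f := fun z : γ × (ℕ × ℕ) => tuplesUpTo (labels (c₁ z.1) (c₂ z.1)) (l z.1))
    (g := fun z m => ([] :: (u z.1).2.map Prod.fst).filterMap fun v =>
      if PredVia (l z.1) (c₁ z.1) (c₂ z.1) z.2 (u z.1).1 m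
        (extendPath v m.length (freshIndex (u z.1).2)) (u z.1).2 then
        some (z.2, unwrite m (extendPath v m.length (freshIndex (u z.1).2)) (u z.1).2) else none)
    ((Primrec.tuplesUpTo (primrec_labels h₁ h₂) hl).comp Primrec.fst) ?_)
  refine Primrec.listFilterMap
    (f := fun z : (γ × (ℕ × ℕ)) × List (Option (ℕ × ℕ)) => [] :: (u z.1.1).2.map Prod.fst)
    (g := fun z v =>
      if PredVia (l z.1.1) (c₁ z.1.1) (c₂ z.1.1) z.1.2 (u z.1.1).1 z.2
        (extendPath v z.2.length (freshIndex (u z.1.1).2)) (u z.1.1).2 then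
        some (z.1.2, unwrite z.2 (extendPath v z.2.length (freshIndex (u z.1.1).2)) (u z.1.1).2)
      else none) ?_ ?_
  · exact Primrec.list_cons.comp (Primrec.const []) (Primrec.list_map
      (Primrec.snd.comp (hu.comp (Primrec.fst.comp Primrec.fst))) (Primrec.fst.comp Primrec.snd))
  · have hx : Primrec fun z : ((γ × (ℕ × ℕ)) × List (Option (ℕ × ℕ))) × List ℕ => z.1.1.1 :=
      Primrec.fst.comp (Primrec.fst.comp Primrec.fst)
    have hq : Primrec fun z : ((γ × (ℕ × ℕ)) × List (Option (ℕ × ℕ))) × List ℕ => z.1.1.2 :=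
      Primrec.snd.comp (Primrec.fst.comp Primrec.fst)
    have hm : Primrec fun z : ((γ × (ℕ × ℕ)) × List (Option (ℕ × ℕ))) × List ℕ => z.1.2 :=
      Primrec.snd.comp Primrec.fst
    have hL := Primrec.snd.comp (hu.comp hx)
    have hy := Primrec.extendPath Primrec.snd (Primrec.list_length.comp hm)
      (Primrec.freshIndex hL)
    exact Primrec.ite (primrec_predVia (hl.comp hx) (h₁.comp hx) (h₂.comp hx) hq
      (Primrec.fst.comp (hu.comp hx)) hm hy hL)
      (Primrec.option_some.comp (hq.pair (Primrec.unwrite hm hy hL))) (Primrec.const none)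

theorem primrec_bads (h₁ : Primrec c₁) (h₂ : Primrec c₂) :
    Primrec fun x => bads (c₁ x) (c₂ x) := by
  classical
  refine Primrec.list_map ?_ (Primrec.snd.pair (Primrec.const []))
  refine Primrec.list_filter_of (primrec_labels h₁ h₂) (.and ?_ (.not ?_))
  · exact Primrec.mem_list (Primrec.fst.comp Primrec.snd)
      ((primrec_globals h₁).comp Primrec.fst)
  · exact Primrec.mem_list (Primrec.snd.comp Primrec.snd)
      ((primrec_globals h₂).comp Primrec.fst)

theorem primrec_flatMap_preds {U : γ → List SymbolicConfig} (hl : Primrec l) (h₁ : Primrec c₁)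
    (h₂ : Primrec c₂) (hU : Primrec U) :
    Primrec fun x => (U x).flatMap (preds (l x) (c₁ x) (c₂ x)) :=
  Primrec.list_flatMap hU (primrec_preds (hl.comp Primrec.fst) (h₁.comp Primrec.fst)
    (h₂.comp Primrec.fst) Primrec.snd)

theorem primrec_backward {k : γ → ℕ} (hl : Primrec l) (h₁ : Primrec c₁) (h₂ : Primrec c₂)
    (hk : Primrec k) : Primrec fun x => backward (l x) (c₁ x) (c₂ x) (k x) :=
  Primrec.nat_iterate hk (primrec_bads h₁ h₂) (primrec_flatMap_preds (hl.comp Primrec.fst)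
    (h₁.comp Primrec.fst) (h₂.comp Primrec.fst) Primrec.snd)

theorem primrec_startConfig (h₁ : Primrec c₁) (h₂ : Primrec c₂) :
    Primrec fun x => startConfig (c₁ x) (c₂ x) :=
  ((primrec_start h₁).pair (primrec_start h₂)).pair (Primrec.const [])

theorem primrec_embedsVia {ψ : γ → List (List ℕ × List ℕ)} {L M : γ → List (List ℕ × (ℕ × ℕ))}
    (hψ : Primrec ψ) (hL : Primrec L) (hM : Primrec M) :
    PrimrecPred fun x => EmbedsVia (ψ x) (L x) (M x) := by
  refine .and (.forall_mem hL (.exists_mem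
    (f := fun z : γ × (List ℕ × (ℕ × ℕ)) => ψ z.1)
    (p := fun (z : γ × (List ℕ × (ℕ × ℕ))) r => r.1 = z.2.1 ∧ (r.2, z.2.2) ∈ M z.1) (hψ.comp Primrec.fst) (.and ?_ ?_)))
    (.forall_mem hψ (.and ?_ (.forall_mem
      (f := fun z : γ × (List ℕ × List ℕ) => ψ z.1)
      (p := fun (z : γ × (List ℕ × List ℕ)) s => z.2.1 <+: s.1 ↔ z.2.2 <+: s.2) (hψ.comp Primrec.fst) (.iff ?_ ?_))))
  · exact Primrec.eq.comp (Primrec.fst.comp Primrec.snd)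
      (Primrec.fst.comp (Primrec.snd.comp Primrec.fst))
  · exact Primrec.mem_list ((Primrec.snd.comp Primrec.snd).pair
      (Primrec.snd.comp (Primrec.snd.comp Primrec.fst))) (hM.comp (Primrec.fst.comp Primrec.fst))
  · exact Primrec.eq.comp (Primrec.list_length.comp (Primrec.snd.comp Primrec.snd))
      (Primrec.list_length.comp (Primrec.fst.comp Primrec.snd))
  · exact Primrec.list_prefix (Primrec.fst.comp (Primrec.snd.comp Primrec.fst))
      (Primrec.fst.comp Primrec.snd)
  · exact Primrec.list_prefix (Primrec.snd.comp (Primrec.snd.comp Primrec.fst))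
      (Primrec.snd.comp Primrec.snd)

theorem primrec_certificate {U : γ → List SymbolicConfig}
    {Ψ : γ → List (List (List ℕ × List ℕ))} (hl : Primrec l) (h₁ : Primrec c₁)
    (h₂ : Primrec c₂) (hU : Primrec U) (hΨ : Primrec Ψ) :
    PrimrecPred fun x => Certificate (l x) (c₁ x) (c₂ x) (U x) (Ψ x) := by
  refine .and (.forall_mem (Primrec.list_append.comp (primrec_bads h₁ h₂)
    (primrec_flatMap_preds hl h₁ h₂ hU)) (.exists_mem
    (f := fun z : γ × SymbolicConfig => U z.1)
    (p := fun (z : γ × SymbolicConfig) u => u.1 = z.2.1 ∧ ∃ ψ ∈ Ψ z.1, EmbedsVia ψ u.2 z.2.2)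
    (hU.comp Primrec.fst) (.and ?_ (.exists_mem
      (f := fun z : (γ × SymbolicConfig) × SymbolicConfig => Ψ z.1.1)
      (p := fun z ψ => EmbedsVia ψ z.2.2 z.1.2.2)
      (hΨ.comp (Primrec.fst.comp Primrec.fst)) ?_)))) (.and (.forall_mem hU ?_) ?_)
  · exact Primrec.eq.comp (Primrec.fst.comp Primrec.snd)
      (Primrec.fst.comp (Primrec.snd.comp Primrec.fst))
  · exact primrec_embedsVia Primrec.snd (Primrec.snd.comp (Primrec.snd.comp Primrec.fst))
      (Primrec.snd.comp (Primrec.snd.comp (Primrec.fst.comp Primrec.fst)))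
  · exact Primrec.isForest (Λ := fun (z : γ × SymbolicConfig) q => Label (c₁ z.1) (c₂ z.1) q)
      (hl.comp Primrec.fst) (primrec_label (γ := (γ × SymbolicConfig) × (ℕ × ℕ))
        (c₁ := fun z => c₁ z.1.1) (c₂ := fun z => c₂ z.1.1) (h₁.comp (Primrec.fst.comp Primrec.fst))
        (h₂.comp (Primrec.fst.comp Primrec.fst)) Primrec.snd) (Primrec.snd.comp Primrec.snd)
  · exact (Primrec.mem_list (primrec_startConfig h₁ h₂) hU).not

end NDCMACode

/-- Unbounded search through all codes, which halts exactly when some code decodes to a witness. -/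
theorem PrimrecPred.rePred_exists {p : γ → β → Prop}
    (hp : PrimrecPred fun z : γ × β => p z.1 z.2) : REPred fun x => ∃ b, p x b := by
  classical
  have h : Primrec₂ fun (x : γ) (n : ℕ) =>
      (Encodable.decode (α := β) n).bind fun b => if p x b then some () else none := by
    refine Primrec.option_bind (Primrec.decode.comp Primrec.snd) ?_
    exact Primrec.ite (hp.comp ((Primrec.fst.comp Primrec.fst).pair Primrec.snd))
      (Primrec.const (some ())) (Primrec.const none)
  refine (Partrec.rfindOpt h.to_comp).dom_re.of_eq fun x => ?_
  rw [Nat.rfindOpt_dom]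
  constructor
  · rintro ⟨n, _, hn⟩
    obtain ⟨b, -, hb⟩ := Option.bind_eq_some_iff.1 hn
    by_cases h : p x b
    · exact ⟨b, h⟩
    · simp [h] at hb
  · rintro ⟨b, hb⟩
    exact ⟨Encodable.encode b, (), by simp [hb]⟩

/-- Post's theorem: the predicate and its complement are both recursively enumerable. -/
theorem computablePred_of_exists {p : γ → Prop} {r : γ → β → Prop} {s : γ → σ → Prop}
    (hr : PrimrecPred fun z : γ × β => r z.1 z.2) (hs : PrimrecPred fun z : γ × σ => s z.1 z.2)
    (hpr : ∀ x, p x ↔ ∃ b, r x b) (hps : ∀ x, ¬ p x ↔ ∃ b, s x b) : ComputablePred p :=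
  ComputablePred.computable_iff_re_compl_re'.2
    ⟨hr.rePred_exists.of_eq fun x => (hpr x).symm, hs.rePred_exists.of_eq fun x => (hps x).symm⟩

theorem ComputablePred.comp_of {p : β → Prop} (hp : ComputablePred p) {f : γ → β}
    (hf : Computable f) : ComputablePred fun x => p (f x) := by
  obtain ⟨_, hp⟩ := hp
  exact ⟨fun x => inferInstance, hp.comp hf⟩

theorem ComputablePred.and_of {p q : γ → Prop} (hp : ComputablePred p)
    (hq : ComputablePred q) : ComputablePred fun x => p x ∧ q x := by
  obtain ⟨_, hp⟩ := hp
  obtain ⟨_, hq⟩ := hq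
  exact ⟨fun x => inferInstance, (Primrec.and.to_comp.comp hp hq).of_eq fun x => by simp⟩

theorem NDCMACode.computablePred_contained : ComputablePred NDCMACode.Contained := by
  let I := ℕ × NDCMACode × NDCMACode
  have hl : Primrec fun x : I => x.1 := Primrec.fst
  have h₁ : Primrec fun x : I => x.2.1 := Primrec.fst.comp Primrec.snd
  have h₂ : Primrec fun x : I => x.2.2 := Primrec.snd.comp Primrec.snd
  have hv : PrimrecPred fun x : I =>
      x.2.1.letters = x.2.2.letters ∧ Valid x.1 x.2.1 ∧ Valid x.1 x.2.2 :=
    (Primrec.eq.comp (primrec_letters h₁) (primrec_letters h₂)).and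
      ((primrec_valid hl h₁).and (primrec_valid hl h₂))
  -- A positive answer is witnessed by a certificate for valid codes, a negative one by invalid
  -- codes or by the number of a round that meets the initial configuration.
  refine computablePred_of_exists
    (r := fun x (z : List SymbolicConfig × List (List (List ℕ × List ℕ))) =>
      (x.2.1.letters = x.2.2.letters ∧ Valid x.1 x.2.1 ∧ Valid x.1 x.2.2) ∧
        Certificate x.1 x.2.1 x.2.2 z.1 z.2)
    (s := fun x (k : ℕ) =>
      ¬ (x.2.1.letters = x.2.2.letters ∧ Valid x.1 x.2.1 ∧ Valid x.1 x.2.2) ∨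
        startConfig x.2.1 x.2.2 ∈ backward x.1 x.2.1 x.2.2 k) ?_ ?_ (fun x => ?_) fun x => ?_
  · exact (hv.comp Primrec.fst).and (primrec_certificate (hl.comp Primrec.fst)
      (h₁.comp Primrec.fst) (h₂.comp Primrec.fst) (Primrec.fst.comp Primrec.snd)
      (Primrec.snd.comp Primrec.snd))
  · exact (hv.comp Primrec.fst).not.or (Primrec.mem_list
      (primrec_startConfig (h₁.comp Primrec.fst) (h₂.comp Primrec.fst))
      (primrec_backward (hl.comp Primrec.fst) (h₁.comp Primrec.fst) (h₂.comp Primrec.fst)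
        Primrec.snd))
  · constructor
    · rintro ⟨h, hr⟩
      obtain ⟨U, Ψ, hc⟩ := exists_certificate hr
      exact ⟨(U, Ψ), h, hc⟩
    · rintro ⟨⟨U, Ψ⟩, h, hc⟩
      exact ⟨h, (not_refuted_iff h.2.1 h.2.2).2 ⟨U, Ψ, hc⟩⟩
  · rw [Contained, Classical.not_and_iff_not_or_not, not_not, Refuted]
    constructor
    · rintro (h | ⟨k, hk⟩)
      · exact ⟨0, Or.inl h⟩
      · exact ⟨k, Or.inr hk⟩
    · rintro ⟨k, h | hk⟩
      · exact Or.inl h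
      · exact Or.inr ⟨k, hk⟩

end Effectivity

/-- Containment and equivalence of deterministic weak NDCMA are decidable: a single algorithm,
which gets the level and the two automata as its input, is correct for every nested data set. -/
theorem mainTheorem9 :
    (∃ P : ℕ × NDCMACode × NDCMACode → Prop, ComputablePred P ∧
      ∀ (l : ℕ) (D : Type u) (N : NestedDataset D l) (c₁ c₂ : NDCMACode),
        P (l, c₁, c₂) ↔ ContainmentInstance N c₁ c₂) ∧
    (∃ P : ℕ × NDCMACode × NDCMACode → Prop, ComputablePred P ∧
      ∀ (l : ℕ) (D : Type u) (N : NestedDataset D l) (c₁ c₂ : NDCMACode),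
        P (l, c₁, c₂) ↔ EquivalenceInstance N c₁ c₂) := by
  have hswap : Computable fun x : ℕ × NDCMACode × NDCMACode => (x.1, x.2.2, x.2.1) :=
    (Primrec.fst.pair ((Primrec.snd.comp Primrec.snd).pair
      (Primrec.fst.comp Primrec.snd))).to_comp
  refine ⟨⟨NDCMACode.Contained, NDCMACode.computablePred_contained,
    fun l D N c₁ c₂ => NDCMACode.contained_iff N c₁ c₂⟩,
    ⟨fun x => NDCMACode.Contained x ∧ NDCMACode.Contained (x.1, x.2.2, x.2.1),
      NDCMACode.computablePred_contained.and_of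
        (NDCMACode.computablePred_contained.comp_of hswap), fun l D N c₁ c₂ => ?_⟩⟩
  rw [NDCMACode.equivalenceInstance_iff, ← NDCMACode.contained_iff, ← NDCMACode.contained_iff]
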